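/- **Setting.** Let $k_1,k_2\ge 1$ be fixed (the case without factors, $k_1=k_2=0$ and $X_t=E_t$, is included). On a probability space let $F_t\in\mathbb R^{k_1\times k_2}$ and $e_{ij,t}\in\mathbb R$ ($i,j,t\ge 1$) be random, let $R=R_{p_1}\in\mathbb R^{p_1\times k_1}$ and $C=C_{p_2}\in\mathbb R^{p_2\times k_2}$ be deterministic, put $E_t=(e_{ij,t})_{i\le p_1,\,j\le p_2}$ and $$X_t=RF_tC'+E_t,\qquad M_c=\frac1{Tp_2}\sum_{t=1}^T X_tX_t' ,$$ and let $\widehat\lambda_1\ge\dots\ge\widehat\lambda_{p_1}$ be the eigenvalues of $M_c$. $\|\cdot\|$ is the spectral norm, $\|\cdot\|_{\max}$ the largest absolute entry; $c_0$ denotes finite constants, possibly different at each occurrence, that do not depend on $p_1,p_2,T$ or on the free indices $1\le t\le T$, $1\le i,l_1\le p_1$, $1\le j,h_1\le p_2$. **B1.** (i) $E F_t=0$, and $E\|F_t\|^{4+\epsilon}\le c_0$ for some $\epsilon>0$. (ii) $T^{-1}\sum_{t\le T}F_tF_t'\to\Sigma_1$ and $T^{-1}\sum_{t\le T}F_t'F_t\to\Sigma_2$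 a.s., with $\Sigma_1,\Sigma_2$ deterministic, positive definite, each with distinct eigenvalues. (iii) For all $h_1,l_1\le k_1$, $h_2,l_2\le k_2$: $E\max_{\tilde t\le T}\big(\sum_{t\le\tilde t}(F_{h_1h_2,t}F_{l_1l_2,t}-E F_{h_1h_2,t}F_{l_1l_2,t})\big)^2\le c_0T$. **B2.** $\|R\|_{\max}\le c_0$, $\|C\|_{\max}\le c_0$, $\|p_1^{-1}R'R-I_{k_1}\|\to0$ as $p_1\to\infty$, and $\|p_2^{-1}C'C-I_{k_2}\|\to0$ as $p_2\to\infty$. **B3.** (i) $E e_{ij,t}=0$, $E e_{ij,t}^8\le c_0$. (ii) $\sum_{s\le T}\sum_{l\le p_1}\sum_{h\le p_2}|E(e_{ij,t}e_{lh,s})|\le c_0$ and $\sum_{l\le p_1}\sum_{h\le p_2}|E(e_{lj,t}e_{ih,t})|\le c_0$. (iii) With $s$ summed over $1,\dots,T$, $l,l_2$ over $1,\dots,p_1$ and $h,h_2$ over $1,\dots,p_2$, the sums $\sum_{s,l_2,h}|\mathrm{Cov}(e_{ij,t}e_{l_1j,t},e_{ih,s}e_{l_2h,s})|$, $\sum_{s,l,h_2}|\mathrm{Cov}(e_{ij,t}e_{ih_1,t},e_{lj,s}e_{lh_2,s})|$,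 $\sum_{s,l,h}|\mathrm{Cov}(e_{ij,t}^2,e_{lh,s}^2)|$ and $\sum_{s,l_2,h_2}|\mathrm{Cov}(e_{ij,t}e_{l_1h_1,t},e_{ij,s}e_{l_2h_2,s})+\mathrm{Cov}(e_{l_1j,t}e_{ih_1,t},e_{l_2j,s}e_{ih_2,s})|$ are all at most $c_0$. (iv) $\lambda_{\min}\big[E\big((p_2T)^{-1}\sum_{t\le T}E_tE_t'\big)\big]>0$ for all $p_1,p_2,T\ge1$. **B4.** (i) $E\big\|T^{-1/2}\sum_{t\le T}F_t\,v'E_tw\big\|^2\le c_0$ for all deterministic unit vectors $v\in\mathbb R^{p_1}$, $w\in\mathbb R^{p_2}$. (ii) The vectors $\bar\zeta_{ij}=\mathrm{Vec}\big(T^{-1/2}\sum_{t\le T}F_te_{ij,t}\big)$ have finite fourth moments, and the four quantities $\|\sum_{h}E(\bar\zeta_{ij}\otimes\bar\zeta_{ih})\|_{\max}$, $\|\sum_{l}E(\bar\zeta_{ij}\otimes\bar\zeta_{lj})\|_{\max}$, $\|\sum_{l,h_2}\mathrm{Cov}(\bar\zeta_{ij}\otimes\bar\zeta_{ih_1},\bar\zeta_{lj}\otimes\bar\zeta_{lh_2})\|_{\max}$,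 $\|\sum_{l_2,h}\mathrm{Cov}(\bar\zeta_{ij}\otimes\bar\zeta_{l_1j},\bar\zeta_{ih}\otimes\bar\zeta_{l_2h})\|_{\max}$ (with $l,l_2\le p_1$ and $h,h_2\le p_2$ summed) are at most $c_0$. **Theorem 1.** Assume B1–B4. All limits are as $\min\{p_1,p_2,T\}\to\infty$, without restriction on the relative rates. 1. For every $1\le j\le k_1$ there is a constant $c>0$ with $\widehat\lambda_j/p_1\to c$ almost surely; that is, $\widehat\lambda_j=\Omega_{a.s.}(p_1)$. 2. There is a finite constant $c_0$ such that, for every $\epsilon>0$ and all $j>k_1$ (uniformly in $k_1<j\le p_1$), $$\widehat\lambda_j\le c_0+o_{a.s.}\!\left(\frac{p_1}{\sqrt{Tp_2}}\,\big(\ln^2p_1\,\ln p_2\,\ln T\big)^{1/2+\epsilon}\right).$$ 3. There is an almost sure eigen-gap: if $k_1\ge1$, then $\widehat\lambda_{k_1+1}/\widehat\lambda_{k_1}\to0$ almost surely. -/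

import Mathlib

open MeasureTheory ProbabilityTheory Filter Topology
open scoped Matrix Matrix.Norms.L2Operator

noncomputable section

namespace MatrixFactor

/-!
Conventions. Rows, columns and times are counted from `0`: `e i j t` is the entry of the error
matrix in row `i + 1` and column `j + 1` at time `t + 1`, so that `t ∈ Finset.range T` runs over the
`T` observation times. The factors `F t` and the errors `e i j t` form one infinite array, from
which the sample of size `(p1, p2, T)` is cut out; the loadings `R p1` and `C p2` may change
with the dimension. The norm of a matrix is the spectral norm.
-/

/-- The `j`-th largest eigenvalue of a real symmetric `n × n` matrix, for `1 ≤ j ≤ n`, counted with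
multiplicity (the value is `0` for other `j`). -/
def eig {n : ℕ} {A : Matrix (Fin n) (Fin n) ℝ} (hA : A.IsHermitian) (j : ℕ) : ℝ :=
  if h : 1 ≤ j ∧ j ≤ n then
    hA.eigenvalues₀ ⟨j - 1, by rw [Fintype.card_fin]; omega⟩
  else 0

variable {Ω : Type*}

/-- The `p1 × p2` error matrix `E_t`. -/
def errMat (e : ℕ → ℕ → ℕ → Ω → ℝ) (p1 p2 t : ℕ) (ω : Ω) : Matrix (Fin p1) (Fin p2) ℝ :=
  Matrix.of fun i j => e i j t ω

/-- The observed matrix `X_t = R F_t C' + E_t`. -/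
def obs {k1 k2 : ℕ} (R : ∀ p1 : ℕ, Matrix (Fin p1) (Fin k1) ℝ)
    (C : ∀ p2 : ℕ, Matrix (Fin p2) (Fin k2) ℝ)
    (F : ℕ → Ω → Matrix (Fin k1) (Fin k2) ℝ) (e : ℕ → ℕ → ℕ → Ω → ℝ)
    (p1 p2 t : ℕ) (ω : Ω) : Matrix (Fin p1) (Fin p2) ℝ :=
  R p1 * F t ω * (C p2)ᵀ + errMat e p1 p2 t ω

/-- The sample second moment matrix `(T p2)⁻¹ ∑ X_t X_t'` of a sequence of matrices. -/
def secondMoment {p1 p2 : ℕ} (T : ℕ) (X : ℕ → Matrix (Fin p1) (Fin p2) ℝ) :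
    Matrix (Fin p1) (Fin p1) ℝ :=
  ((T : ℝ) * (p2 : ℝ))⁻¹ • ∑ t ∈ Finset.range T, X t * (X t)ᵀ

theorem secondMoment_isHermitian {p1 p2 : ℕ} (T : ℕ) (X : ℕ → Matrix (Fin p1) (Fin p2) ℝ) :
    (secondMoment T X).IsHermitian := by
  unfold Matrix.IsHermitian secondMoment
  rw [Matrix.conjTranspose_smul, Matrix.conjTranspose_sum]
  simp [Matrix.conjTranspose_eq_transpose_of_trivial, Matrix.transpose_mul]

/-- The `j`-th largest eigenvalue of the flattened column covariance matrix
`M_c = (T p2)⁻¹ ∑ X_t X_t'`. -/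
def lamHat {k1 k2 : ℕ} (R : ∀ p1 : ℕ, Matrix (Fin p1) (Fin k1) ℝ)
    (C : ∀ p2 : ℕ, Matrix (Fin p2) (Fin k2) ℝ)
    (F : ℕ → Ω → Matrix (Fin k1) (Fin k2) ℝ) (e : ℕ → ℕ → ℕ → Ω → ℝ)
    (j p1 p2 T : ℕ) (ω : Ω) : ℝ :=
  eig (secondMoment_isHermitian T fun t => obs R C F e p1 p2 t ω) j

/-- The rate `p1 / √(T p2) * (ln² p1 * ln p2 * ln T) ^ (1/2 + ε)`. -/
def rate (ε : ℝ) (p1 p2 T : ℕ) : ℝ :=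
  (p1 : ℝ) / √((T : ℝ) * (p2 : ℝ)) *
    (Real.log p1 ^ 2 * Real.log p2 * Real.log T) ^ (1 / 2 + ε : ℝ)

variable [MeasurableSpace Ω]

/-- A symmetric positive definite matrix with pairwise distinct eigenvalues. -/
def PosDefDistinct {k : ℕ} (S : Matrix (Fin k) (Fin k) ℝ) : Prop :=
  S.PosDef ∧ ∃ hS : S.IsHermitian, Function.Injective hS.eigenvalues

/-- Assumption B1, on the common factors. -/
structure AssumptionB1 {k1 k2 : ℕ} (μ : Measure Ω)
    (F : ℕ → Ω → Matrix (Fin k1) (Fin k2) ℝ) : Prop where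
  mean_zero : ∀ t a b, ∫ ω, F t ω a b ∂μ = 0
  moment : ∃ ε : ℝ, 0 < ε ∧ ∃ c : ℝ, ∀ t,
    ∫⁻ ω, ENNReal.ofReal (‖F t ω‖ ^ (4 + ε)) ∂μ ≤ ENNReal.ofReal c
  cov_row : ∃ S : Matrix (Fin k1) (Fin k1) ℝ, PosDefDistinct S ∧
    ∀ᵐ ω ∂μ, Tendsto (fun T : ℕ => (T : ℝ)⁻¹ • ∑ t ∈ Finset.range T, F t ω * (F t ω)ᵀ)
      atTop (𝓝 S)
  cov_col : ∃ S : Matrix (Fin k2) (Fin k2) ℝ, PosDefDistinct S ∧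
    ∀ᵐ ω ∂μ, Tendsto (fun T : ℕ => (T : ℝ)⁻¹ • ∑ t ∈ Finset.range T, (F t ω)ᵀ * F t ω)
      atTop (𝓝 S)
  maximal : ∃ c : ℝ, ∀ (h1 l1 : Fin k1) (h2 l2 : Fin k2) (T : ℕ),
    ∫⁻ ω, (⨆ T' ∈ Finset.Icc 1 T, ENNReal.ofReal
      ((∑ t ∈ Finset.range T', (F t ω h1 h2 * F t ω l1 l2
        - ∫ ω', F t ω' h1 h2 * F t ω' l1 l2 ∂μ)) ^ 2)) ∂μ ≤ ENNReal.ofReal (c * T)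

/-- Assumption B2, on the loadings. -/
structure AssumptionB2 {k1 k2 : ℕ} (R : ∀ p1 : ℕ, Matrix (Fin p1) (Fin k1) ℝ)
    (C : ∀ p2 : ℕ, Matrix (Fin p2) (Fin k2) ℝ) : Prop where
  bound_R : ∃ c : ℝ, ∀ p1 i a, |R p1 i a| ≤ c
  bound_C : ∃ c : ℝ, ∀ p2 j b, |C p2 j b| ≤ c
  lim_R : Tendsto (fun p1 : ℕ => ‖(p1 : ℝ)⁻¹ • ((R p1)ᵀ * R p1) - 1‖) atTop (𝓝 0)
  lim_C : Tendsto (fun p2 : ℕ => ‖(p2 : ℝ)⁻¹ • ((C p2)ᵀ * C p2) - 1‖) atTop (𝓝 0)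

/-- The expectation of `(p2 T)⁻¹ ∑ E_t E_t'`. -/
def errSecondMomentMean (μ : Measure Ω) (e : ℕ → ℕ → ℕ → Ω → ℝ) (p1 p2 T : ℕ) :
    Matrix (Fin p1) (Fin p1) ℝ :=
  Matrix.of fun i l => ∫ ω, secondMoment T (fun t => errMat e p1 p2 t ω) i l ∂μ

theorem errSecondMomentMean_isHermitian (μ : Measure Ω) (e : ℕ → ℕ → ℕ → Ω → ℝ) (p1 p2 T : ℕ) :
    (errSecondMomentMean μ e p1 p2 T).IsHermitian := by
  refine Matrix.IsHermitian.ext fun i l => ?_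
  simp only [errSecondMomentMean, Matrix.of_apply, star_trivial]
  congr 1
  funext ω
  have h := (secondMoment_isHermitian T (fun t => errMat e p1 p2 t ω)).apply i l
  simpa using h

/-- Assumption B3, on the errors. The constants do not depend on `p1`, `p2`, `T` or on the free
indices; `l1` and `h1` are free indices in `cov_a_row`, `cov_a_col` and `cov_b`. -/
structure AssumptionB3 (μ : Measure Ω) (e : ℕ → ℕ → ℕ → Ω → ℝ) : Prop where
  mean_zero : ∀ i j t, ∫ ω, e i j t ω ∂μ = 0
  moment : ∃ c : ℝ, ∀ i j t, ∫⁻ ω, ENNReal.ofReal (e i j t ω ^ 8) ∂μ ≤ ENNReal.ofReal c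
  dep_a : ∃ c : ℝ, ∀ p1 p2 T i j t : ℕ, i < p1 → j < p2 → t < T →
    ∑ s ∈ Finset.range T, ∑ l ∈ Finset.range p1, ∑ h ∈ Finset.range p2,
      |∫ ω, e i j t ω * e l h s ω ∂μ| ≤ c
  dep_b : ∃ c : ℝ, ∀ p1 p2 T i j t : ℕ, i < p1 → j < p2 → t < T →
    ∑ l ∈ Finset.range p1, ∑ h ∈ Finset.range p2, |∫ ω, e l j t ω * e i h t ω ∂μ| ≤ c
  cov_a_row : ∃ c : ℝ, ∀ p1 p2 T i j t l1 : ℕ, i < p1 → j < p2 → t < T → l1 < p1 →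
    ∑ s ∈ Finset.range T, ∑ l2 ∈ Finset.range p1, ∑ h ∈ Finset.range p2,
      |cov[fun ω => e i j t ω * e l1 j t ω, fun ω => e i h s ω * e l2 h s ω; μ]| ≤ c
  cov_a_col : ∃ c : ℝ, ∀ p1 p2 T i j t h1 : ℕ, i < p1 → j < p2 → t < T → h1 < p2 →
    ∑ s ∈ Finset.range T, ∑ l ∈ Finset.range p1, ∑ h2 ∈ Finset.range p2,
      |cov[fun ω => e i j t ω * e i h1 t ω, fun ω => e l j s ω * e l h2 s ω; μ]| ≤ c
  cov_a_sq : ∃ c : ℝ, ∀ p1 p2 T i j t : ℕ, i < p1 → j < p2 → t < T →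
    ∑ s ∈ Finset.range T, ∑ l ∈ Finset.range p1, ∑ h ∈ Finset.range p2,
      |cov[fun ω => e i j t ω * e i j t ω, fun ω => e l h s ω * e l h s ω; μ]| ≤ c
  cov_b : ∃ c : ℝ, ∀ p1 p2 T i j t l1 h1 : ℕ, i < p1 → j < p2 → t < T → l1 < p1 → h1 < p2 →
    ∑ s ∈ Finset.range T, ∑ l2 ∈ Finset.range p1, ∑ h2 ∈ Finset.range p2,
      |cov[fun ω => e i j t ω * e l1 h1 t ω, fun ω => e i j s ω * e l2 h2 s ω; μ]
        + cov[fun ω => e l1 j t ω * e i h1 t ω, fun ω => e l2 j s ω * e i h2 s ω; μ]| ≤ c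
  eig_min_pos : ∀ p1 p2 T : ℕ, 1 ≤ p1 → 1 ≤ p2 → 1 ≤ T →
    0 < eig (errSecondMomentMean_isHermitian μ e p1 p2 T) p1

/-- The entry with index `a` of the vector `ζ_{ij} = Vec (∑ F_t e_{ij,t} / √T)`. -/
def zeta {k1 k2 : ℕ} (F : ℕ → Ω → Matrix (Fin k1) (Fin k2) ℝ) (e : ℕ → ℕ → ℕ → Ω → ℝ)
    (T i j : ℕ) (a : Fin k1 × Fin k2) (ω : Ω) : ℝ :=
  (√(T : ℝ))⁻¹ * ∑ t ∈ Finset.range T, F t ω a.1 a.2 * e i j t ω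

/-- Assumption B4, on the dependence between factors and errors. The entries of
`ζ_{ij} ⊗ ζ_{ih}` are the products `ζ_{ij} a * ζ_{ih} b`; `zeta_memLp` says that the covariances
in `cov_row` and `cov_col` exist. -/
structure AssumptionB4 {k1 k2 : ℕ} (μ : Measure Ω)
    (F : ℕ → Ω → Matrix (Fin k1) (Fin k2) ℝ) (e : ℕ → ℕ → ℕ → Ω → ℝ) : Prop where
  bilinear : ∃ c : ℝ, ∀ (p1 p2 T : ℕ) (v : EuclideanSpace ℝ (Fin p1))
    (w : EuclideanSpace ℝ (Fin p2)), ‖v‖ = 1 → ‖w‖ = 1 →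
    ∫⁻ ω, ENNReal.ofReal (‖(√(T : ℝ))⁻¹ • ∑ t ∈ Finset.range T,
      (∑ i, ∑ j, v i * errMat e p1 p2 t ω i j * w j) • F t ω‖ ^ 2) ∂μ ≤ ENNReal.ofReal c
  zeta_memLp : ∀ T i j a, MemLp (zeta F e T i j a) 4 μ
  mean_row : ∃ c : ℝ, ∀ p1 p2 T i j : ℕ, i < p1 → j < p2 → ∀ a b : Fin k1 × Fin k2,
    |∑ h ∈ Finset.range p2, ∫ ω, zeta F e T i j a ω * zeta F e T i h b ω ∂μ| ≤ c
  mean_col : ∃ c : ℝ, ∀ p1 p2 T i j : ℕ, i < p1 → j < p2 → ∀ a b : Fin k1 × Fin k2,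
    |∑ l ∈ Finset.range p1, ∫ ω, zeta F e T i j a ω * zeta F e T l j b ω ∂μ| ≤ c
  cov_row : ∃ c : ℝ, ∀ p1 p2 T i j h1 : ℕ, i < p1 → j < p2 → h1 < p2 →
    ∀ a b a' b' : Fin k1 × Fin k2,
    |∑ l ∈ Finset.range p1, ∑ h2 ∈ Finset.range p2,
      cov[fun ω => zeta F e T i j a ω * zeta F e T i h1 b ω,
        fun ω => zeta F e T l j a' ω * zeta F e T l h2 b' ω; μ]| ≤ c
  cov_col : ∃ c : ℝ, ∀ p1 p2 T i j l1 : ℕ, i < p1 → j < p2 → l1 < p1 →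
    ∀ a b a' b' : Fin k1 × Fin k2,
    |∑ l2 ∈ Finset.range p1, ∑ h ∈ Finset.range p2,
      cov[fun ω => zeta F e T i j a ω * zeta F e T l1 j b ω,
        fun ω => zeta F e T i h a' ω * zeta F e T l2 h b' ω; μ]| ≤ c

end MatrixFactor

end

namespace MatrixFactor

/-! ### Ordered eigenvalues and quadratic forms -/

/-! The form of `M_c` at v is (T p2)⁻¹ ∑ |X_t' v|², and X_t' v = C F_t' w + E_t' v with w = R' v.
Since C'C ≈ p2 I, R'R ≈ p1 I and T⁻¹ ∑ F_t F_t' → S, the signal part alone has j-th eigenvalue about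
p1 times that of S for j ≤ k1, and it vanishes on the space R' v = 0 of codimension at most k1. By
Courant–Fischer everything reduces to bounding the noise form ∑ |E_t' v|².

The Gram matrix ∑ E_t E_t' has a mean with row sums O(p2 T) (Schur test) and a deviation whose
squared Frobenius norm has expectation O(p1² p2 T). After division by T p2 this is a constant plus
order p1 / √(T p2). The noise form is monotone in all three dimensions, so almost sure bounds are
needed only at dyadic corners, where summability costs the logarithms: `ae_noiseForm_le_rate`, which
gives the second claim.

That rate need not be o(p1), because ln p1 may outgrow T p2. The matrices E_t' E_t supply a second
bound, good when p1 is large. Relative to (p1 p2 T)², the two squared deviations have mean sizes 1 /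
(p2 T) and 1 / p1. Their minimum is at most 1 / √(p1 p2 T), summable over dyadic triples whatever
the relative rates: `ae_noiseForm_le_dim`. Noise of size o(p1) gives the first claim
(`tendsto_lamHat_div`) and the eigen-gap. -/

theorem exists_ordered_eigenbasis {n : ℕ} {A : Matrix (Fin n) (Fin n) ℝ} (hA : A.IsHermitian) :
    ∃ (b : Fin n → Fin n → ℝ) (lam : Fin n → ℝ), Antitone lam ∧
      (∀ (j : ℕ) (h1 : 1 ≤ j) (h2 : j ≤ n), eig hA j = lam ⟨j - 1, by omega⟩) ∧
      (∀ v, v ⬝ᵥ v = ∑ i, (b i ⬝ᵥ v) ^ 2) ∧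
      (∀ v, v ⬝ᵥ A *ᵥ v = ∑ i, lam i * (b i ⬝ᵥ v) ^ 2) := by
  -- `eigenvalues` is `eigenvalues₀` reindexed by an arbitrary equivalence; `σ` undoes it, so that
  -- position i carries the (i+1)-th largest eigenvalue.
  set σ : Fin n ≃ Fin n := (Fintype.equivOfCardEq (Fintype.card_fin _) :
    Fin (Fintype.card (Fin n)) ≃ Fin n).symm.trans (finCongr (Fintype.card_fin n)) with hσ
  set B := hA.eigenvectorBasis.reindex σ with hB
  set lam : Fin n → ℝ := fun i => hA.eigenvalues₀ ((finCongr (Fintype.card_fin n)).symm i)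
    with hlam
  have hin : ∀ (i : Fin n) (v : Fin n → ℝ),
      inner ℝ (B i) (WithLp.toLp 2 v) = (B i).ofLp ⬝ᵥ v := by
    intro i v
    rw [EuclideanSpace.inner_eq_star_dotProduct]
    simp [dotProduct_comm]
  have hexp : ∀ v : Fin n → ℝ, v = ∑ i, ((B i).ofLp ⬝ᵥ v) • (B i).ofLp := by
    intro v
    have h := B.sum_repr' (WithLp.toLp 2 v)
    have h' := congrArg WithLp.ofLp h
    simp only [hin] at h'
    simpa using h'.symm
  have heig : ∀ i, A *ᵥ (B i).ofLp = lam i • (B i).ofLp := by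
    intro i
    have h := hA.mulVec_eigenvectorBasis (σ.symm i)
    have e1 : hA.eigenvalues (σ.symm i) = lam i := by
      simp [Matrix.IsHermitian.eigenvalues, hlam, hσ]
    rw [e1] at h
    simpa [hB] using h
  refine ⟨fun i => (B i).ofLp, lam, ?_, ?_, ?_, ?_⟩
  · intro i j hij
    exact hA.eigenvalues₀_antitone (by simpa using hij)
  · intro j h1 h2
    rw [eig, dif_pos ⟨h1, h2⟩]
    rfl
  · intro v
    refine (congrArg (· ⬝ᵥ v) (hexp v)).trans ?_
    rw [sum_dotProduct]
    refine Finset.sum_congr rfl fun i _ => ?_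
    rw [smul_dotProduct, smul_eq_mul, sq]
  · intro v
    have : A *ᵥ v = ∑ i, ((B i).ofLp ⬝ᵥ v) • lam i • (B i).ofLp := by
      conv_lhs => rw [hexp v]
      rw [Matrix.mulVec_sum]
      simp only [Matrix.mulVec_smul, heig]
    rw [this, dotProduct_sum]
    refine Finset.sum_congr rfl fun i _ => ?_
    rw [dotProduct_smul, dotProduct_smul, smul_eq_mul, smul_eq_mul, dotProduct_comm v]
    ring

/-- Courant–Fischer, upper half: a bound of the quadratic form on a subspace of codimension less
than `j` bounds the `j`-th eigenvalue. -/
theorem eig_le_of_form_le {n : ℕ} {A : Matrix (Fin n) (Fin n) ℝ} (hA : A.IsHermitian) {j m : ℕ}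
    (hj : j ≤ n) (hm : m < j) (L : (Fin n → ℝ) →ₗ[ℝ] (Fin m → ℝ)) {x : ℝ}
    (h : ∀ v, L v = 0 → v ⬝ᵥ A *ᵥ v ≤ x * (v ⬝ᵥ v)) : eig hA j ≤ x := by
  obtain ⟨b, lam, hlam, heig, hsq, hform⟩ := exists_ordered_eigenbasis hA
  -- `G` reads the coordinates on the eigenvectors after the j-th. Together `L` and `G` impose m +
  -- (n - j) < n conditions, so some nonzero v in ker `L` lies in the span of the first j
  -- eigenvectors.
  let G : (Fin n → ℝ) →ₗ[ℝ] (Fin (n - j) → ℝ) :=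
    Matrix.mulVecLin (Matrix.of fun l : Fin (n - j) => b ⟨l + j, by omega⟩)
  have hk : LinearMap.ker (L.prod G) ≠ ⊥ := by
    apply LinearMap.ker_ne_bot_of_finrank_lt
    simp only [Module.finrank_prod, Module.finrank_fin_fun]
    omega
  obtain ⟨v, hv, hv0⟩ := Submodule.exists_mem_ne_zero_of_ne_bot hk
  rw [LinearMap.mem_ker, LinearMap.prod_apply, Function.prod_apply, Prod.mk_eq_zero] at hv
  have hG : ∀ l : Fin n, j ≤ l → b l ⬝ᵥ v = 0 := by
    intro l hl
    have := congrFun hv.2 ⟨l - j, by omega⟩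
    have e : (⟨l - j + j, by omega⟩ : Fin n) = l := Fin.ext (by simp; omega)
    simpa [G, Matrix.mulVec, e] using this
  have hpos : 0 < v ⬝ᵥ v :=
    lt_of_le_of_ne (by simpa using dotProduct_star_self_nonneg v)
      (fun h0 => hv0 (dotProduct_self_eq_zero.1 h0.symm))
  have hge : eig hA j * (v ⬝ᵥ v) ≤ v ⬝ᵥ A *ᵥ v := by
    rw [heig j (by omega) hj, hsq, hform, Finset.mul_sum]
    refine Finset.sum_le_sum fun i _ => ?_
    rcases le_or_gt j i with hi | hi
    · simp [hG i hi]
    · exact mul_le_mul_of_nonneg_right (hlam (Fin.mk_le_mk.2 (by omega))) (sq_nonneg _)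
  exact le_of_mul_le_mul_right (hge.trans (h v hv.1)) hpos

/-- Courant–Fischer, lower half: a lower bound of the quadratic form on a subspace of dimension
`j` bounds the `j`-th eigenvalue from below. -/
theorem le_eig_of_le_form {n : ℕ} {A : Matrix (Fin n) (Fin n) ℝ} (hA : A.IsHermitian) {j k : ℕ}
    (h1 : 1 ≤ j) (hj : j ≤ n) {m : ℕ} (hm : m + j ≤ k) (K : (Fin k → ℝ) →ₗ[ℝ] (Fin m → ℝ))
    (L : (Fin k → ℝ) →ₗ[ℝ] (Fin n → ℝ)) (hL : ∀ u, L u = 0 → u = 0) {x : ℝ}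
    (h : ∀ u, K u = 0 → x * (L u ⬝ᵥ L u) ≤ L u ⬝ᵥ A *ᵥ L u) : x ≤ eig hA j := by
  obtain ⟨b, lam, hlam, heig, hsq, hform⟩ := exists_ordered_eigenbasis hA
  -- ker `K` has dimension at least k - m ≥ j; killing the first j - 1 eigencoordinates of `L u`
  -- leaves a nonzero u.
  let G : (Fin n → ℝ) →ₗ[ℝ] (Fin (j - 1) → ℝ) :=
    Matrix.mulVecLin (Matrix.of fun l : Fin (j - 1) => b ⟨l, by omega⟩)
  have hk : LinearMap.ker (K.prod (G ∘ₗ L)) ≠ ⊥ := by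
    apply LinearMap.ker_ne_bot_of_finrank_lt
    simp only [Module.finrank_prod, Module.finrank_fin_fun]
    omega
  obtain ⟨u, hu, hu0⟩ := Submodule.exists_mem_ne_zero_of_ne_bot hk
  rw [LinearMap.mem_ker, LinearMap.prod_apply, Function.prod_apply, Prod.mk_eq_zero] at hu
  set v := L u with hv
  have hv0 : v ≠ 0 := fun h0 => hu0 (hL u h0)
  have hG : ∀ l : Fin n, l + 1 < j → b l ⬝ᵥ v = 0 := by
    intro l hl
    have := congrFun hu.2 ⟨l, by omega⟩
    simpa [G, Matrix.mulVec] using this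
  have hpos : 0 < v ⬝ᵥ v :=
    lt_of_le_of_ne (by simpa using dotProduct_star_self_nonneg v)
      (fun h0 => hv0 (dotProduct_self_eq_zero.1 h0.symm))
  have hge : v ⬝ᵥ A *ᵥ v ≤ eig hA j * (v ⬝ᵥ v) := by
    rw [heig j (by omega) hj, hsq, hform, Finset.mul_sum]
    refine Finset.sum_le_sum fun i _ => ?_
    rcases lt_or_ge (i + 1 : ℕ) j with hi | hi
    · simp [hG i hi]
    · exact mul_le_mul_of_nonneg_right (hlam (Fin.mk_le_mk.2 (by omega))) (sq_nonneg _)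
  exact le_of_mul_le_mul_right ((h u hu.1).trans hge) hpos

/-- On the orthogonal complement of the first `j - 1` eigenvectors the form is at most the `j`-th
eigenvalue. -/
theorem exists_form_le_eig {n : ℕ} {A : Matrix (Fin n) (Fin n) ℝ} (hA : A.IsHermitian) {j : ℕ}
    (h1 : 1 ≤ j) (hj : j ≤ n) : ∃ L : (Fin n → ℝ) →ₗ[ℝ] (Fin (j - 1) → ℝ),
      ∀ v, L v = 0 → v ⬝ᵥ A *ᵥ v ≤ eig hA j * (v ⬝ᵥ v) := by
  obtain ⟨b, lam, hlam, heig, hsq, hform⟩ := exists_ordered_eigenbasis hA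
  refine ⟨Matrix.mulVecLin (Matrix.of fun l : Fin (j - 1) => b ⟨l, by omega⟩), fun v hv => ?_⟩
  rw [heig j h1 hj, hsq, hform, Finset.mul_sum]
  refine Finset.sum_le_sum fun i _ => ?_
  rcases lt_or_ge (i + 1 : ℕ) j with hi | hi
  · have : b i ⬝ᵥ v = 0 := by
      simpa [Matrix.mulVec] using congrFun hv ⟨i, by omega⟩
    simp [this]
  · exact mul_le_mul_of_nonneg_right (hlam (Fin.mk_le_mk.2 (by omega))) (sq_nonneg _)

/-- On the span of the first `j` eigenvectors the form is at least the `j`-th eigenvalue. -/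
theorem exists_eig_le_form {n : ℕ} {A : Matrix (Fin n) (Fin n) ℝ} (hA : A.IsHermitian) {j : ℕ}
    (h1 : 1 ≤ j) (hj : j ≤ n) : ∃ K : (Fin n → ℝ) →ₗ[ℝ] (Fin (n - j) → ℝ),
      ∀ v, K v = 0 → eig hA j * (v ⬝ᵥ v) ≤ v ⬝ᵥ A *ᵥ v := by
  obtain ⟨b, lam, hlam, heig, hsq, hform⟩ := exists_ordered_eigenbasis hA
  refine ⟨Matrix.mulVecLin (Matrix.of fun l : Fin (n - j) => b ⟨l + j, by omega⟩),
    fun v hv => ?_⟩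
  rw [heig j h1 hj, hsq, hform, Finset.mul_sum]
  refine Finset.sum_le_sum fun i _ => ?_
  rcases le_or_gt j i with hi | hi
  · have e : (⟨i - j + j, by omega⟩ : Fin n) = i := Fin.ext (by simp; omega)
    have : b i ⬝ᵥ v = 0 := by
      simpa [Matrix.mulVec, e] using congrFun hv ⟨i - j, by omega⟩
    simp [this]
  · exact mul_le_mul_of_nonneg_right (hlam (Fin.mk_le_mk.2 (by omega))) (sq_nonneg _)

theorem eig_pos {n : ℕ} {A : Matrix (Fin n) (Fin n) ℝ} (hA : A.PosDef) {j : ℕ}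
    (h1 : 1 ≤ j) (hj : j ≤ n) : 0 < eig hA.isHermitian j := by
  rw [eig, dif_pos ⟨h1, hj⟩]
  have := hA.eigenvalues_pos ((Fintype.equivOfCardEq (Fintype.card_fin _)) ⟨j - 1, by
    rw [Fintype.card_fin]; omega⟩)
  simpa [Matrix.IsHermitian.eigenvalues] using this

theorem eig_nonneg {n : ℕ} {A : Matrix (Fin n) (Fin n) ℝ} (hA : A.IsHermitian)
    (h : ∀ v, 0 ≤ v ⬝ᵥ A *ᵥ v) (j : ℕ) : 0 ≤ eig hA j := by
  by_cases hj : 1 ≤ j ∧ j ≤ n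
  · refine le_eig_of_le_form hA (m := n - j) hj.1 hj.2 (by omega) 0 LinearMap.id
      (fun u hu => hu) fun u _ => ?_
    simpa using h u
  · rw [eig, dif_neg hj]

theorem abs_form_le {n : ℕ} (A : Matrix (Fin n) (Fin n) ℝ) (v : Fin n → ℝ) :
    |v ⬝ᵥ A *ᵥ v| ≤ ‖A‖ * (v ⬝ᵥ v) := by
  have h1 := A.l2_opNorm_mulVec (WithLp.toLp 2 v)
  have h2 := abs_real_inner_le_norm (WithLp.toLp 2 v) (WithLp.toLp 2 (A *ᵥ v))
  have h3 : inner ℝ (WithLp.toLp 2 v) (WithLp.toLp 2 (A *ᵥ v)) = v ⬝ᵥ A *ᵥ v := by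
    rw [EuclideanSpace.inner_eq_star_dotProduct]; simp [dotProduct_comm]
  have h4 : v ⬝ᵥ v = ‖WithLp.toLp 2 v‖ * ‖WithLp.toLp 2 v‖ := by
    rw [← real_inner_self_eq_norm_mul_norm, EuclideanSpace.inner_eq_star_dotProduct]; simp
  rw [h3] at h2
  rw [h4]
  calc _ ≤ _ := h2
    _ ≤ ‖WithLp.toLp 2 v‖ * (‖A‖ * ‖WithLp.toLp 2 v‖) :=
      mul_le_mul_of_nonneg_left h1 (norm_nonneg _)
    _ = _ := by ring

end MatrixFactor

namespace MatrixFactor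

/-! ### Gram matrices close to a matrix with bounded row sums -/

/-- Split the Gram matrix as m plus a remainder. The Schur test, from 2|v_i v_l| ≤ v_i² + v_l²,
bounds the form of the symmetric m by its row sums; Cauchy–Schwarz bounds the remainder by its
Frobenius norm. -/
theorem sum_sq_le_of_rowSum_le {ι κ : Type*} (s : Finset ι) (a : Finset κ) (x : κ → ι → ℝ)
    (m : ι → ι → ℝ) {C : ℝ} (hsymm : ∀ i l, m i l = m l i)
    (hm : ∀ i ∈ s, ∑ l ∈ s, |m i l| ≤ C) (v : ι → ℝ) :
    ∑ k ∈ a, (∑ i ∈ s, v i * x k i) ^ 2 ≤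
      (C + √(∑ i ∈ s, ∑ l ∈ s, (∑ k ∈ a, x k i * x k l - m i l) ^ 2)) * ∑ i ∈ s, v i ^ 2 := by
  have h0 : ∑ k ∈ a, (∑ i ∈ s, v i * x k i) ^ 2 =
      (∑ i ∈ s, ∑ l ∈ s, v i * v l * m i l) +
        ∑ i ∈ s, ∑ l ∈ s, (v i * v l) * (∑ k ∈ a, x k i * x k l - m i l) := by
    simp_rw [← Finset.sum_add_distrib, ← mul_add, add_sub_cancel, Finset.mul_sum, sq,
      Finset.sum_mul_sum]
    rw [Finset.sum_comm]
    refine Finset.sum_congr rfl fun i _ => ?_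
    rw [Finset.sum_comm]
    refine Finset.sum_congr rfl fun l _ => Finset.sum_congr rfl fun k _ => by ring
  have h1 : ∑ i ∈ s, ∑ l ∈ s, v i * v l * m i l ≤ C * ∑ i ∈ s, v i ^ 2 := by
    have hA : ∑ i ∈ s, ∑ l ∈ s, |m i l| * v i ^ 2 ≤ C * ∑ i ∈ s, v i ^ 2 := by
      rw [Finset.mul_sum]
      refine Finset.sum_le_sum fun i hi => ?_
      rw [← Finset.sum_mul]
      exact mul_le_mul_of_nonneg_right (hm i hi) (sq_nonneg _)
    have hB : ∑ i ∈ s, ∑ l ∈ s, |m i l| * v l ^ 2 ≤ C * ∑ i ∈ s, v i ^ 2 := by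
      rw [Finset.sum_comm]
      simpa only [hsymm] using hA
    have hC : ∑ i ∈ s, ∑ l ∈ s, v i * v l * m i l ≤
        (∑ i ∈ s, ∑ l ∈ s, |m i l| * v i ^ 2 + ∑ i ∈ s, ∑ l ∈ s, |m i l| * v l ^ 2) / 2 := by
      rw [← Finset.sum_add_distrib, Finset.sum_div]
      refine Finset.sum_le_sum fun i _ => ?_
      rw [← Finset.sum_add_distrib, Finset.sum_div]
      refine Finset.sum_le_sum fun l _ => ?_
      rcases abs_cases (m i l) with ⟨h, h'⟩ | ⟨h, h'⟩ <;> rw [h]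
      · nlinarith [mul_nonneg h' (sq_nonneg (v i - v l))]
      · nlinarith [mul_nonneg (neg_pos.2 h').le (sq_nonneg (v i + v l))]
    linarith
  have h2 : ∑ i ∈ s, ∑ l ∈ s, (v i * v l) * (∑ k ∈ a, x k i * x k l - m i l) ≤
      √(∑ i ∈ s, ∑ l ∈ s, (∑ k ∈ a, x k i * x k l - m i l) ^ 2) * ∑ i ∈ s, v i ^ 2 := by
    have h := Real.sum_mul_le_sqrt_mul_sqrt (s ×ˢ s) (fun p => v p.1 * v p.2)
      (fun p => ∑ k ∈ a, x k p.1 * x k p.2 - m p.1 p.2)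
    simp only [Finset.sum_product, mul_pow] at h
    rw [← Finset.sum_mul_sum, Real.sqrt_mul_self (Finset.sum_nonneg fun i _ => sq_nonneg _),
      mul_comm (∑ i ∈ s, v i ^ 2)] at h
    exact h
  rw [h0, add_mul]
  exact add_le_add h1 h2

/-- A bound for `x x'` is a bound for `x' x`. -/
theorem sum_sq_le_of_dual {ι κ : Type*} (s : Finset ι) (a : Finset κ) (x : κ → ι → ℝ) {B : ℝ}
    (hB : 0 ≤ B)
    (h : ∀ y : κ → ℝ, ∑ i ∈ s, (∑ k ∈ a, y k * x k i) ^ 2 ≤ B * ∑ k ∈ a, y k ^ 2) (v : ι → ℝ) :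
    ∑ k ∈ a, (∑ i ∈ s, v i * x k i) ^ 2 ≤ B * ∑ i ∈ s, v i ^ 2 := by
  set y : κ → ℝ := fun k => ∑ i ∈ s, v i * x k i with hy
  set S := ∑ k ∈ a, y k ^ 2 with hS
  -- With y = x v, S = |y|² is the pairing of v with x' y, so S² ≤ |v|² · B S; then S cancels.
  have e : S = ∑ i ∈ s, v i * ∑ k ∈ a, y k * x k i := by
    simp_rw [hS, Finset.mul_sum]
    rw [Finset.sum_comm]
    refine Finset.sum_congr rfl fun k _ => ?_
    rw [sq]
    conv_lhs => rw [hy]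
    rw [Finset.sum_mul]
    refine Finset.sum_congr rfl fun i _ => by simp only [hy]; ring
  have h1 := Finset.sum_mul_sq_le_sq_mul_sq s v (fun i => ∑ k ∈ a, y k * x k i)
  rw [← e] at h1
  have hv : 0 ≤ ∑ i ∈ s, v i ^ 2 := Finset.sum_nonneg fun i _ => sq_nonneg _
  have h2 := h1.trans (mul_le_mul_of_nonneg_left (h y) hv)
  rw [← hS] at h2
  have hS0 : 0 ≤ S := Finset.sum_nonneg fun i _ => sq_nonneg _
  change S ≤ _
  rcases hS0.eq_or_lt with h0 | h0
  · rw [← h0]; positivity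
  · refine le_of_mul_le_mul_right ?_ h0
    nlinarith

variable {Ω : Type*} [MeasurableSpace Ω] {μ : Measure Ω}

/-! ### Probabilistic tools -/

theorem lintegral_sum_sub_sq_le [IsProbabilityMeasure μ] {κ : Type*} (a : Finset κ) (Z : κ → Ω → ℝ)
    (hZ : ∀ k, MemLp (Z k) 2 μ) {B : ℝ} (hB : ∑ k ∈ a, ∑ k' ∈ a, |cov[Z k, Z k'; μ]| ≤ B) :
    ∫⁻ ω, ENNReal.ofReal ((∑ k ∈ a, Z k ω - ∑ k ∈ a, ∫ ω', Z k ω' ∂μ) ^ 2) ∂μ ≤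
      ENNReal.ofReal B := by
  have hm : MemLp (fun ω => ∑ k ∈ a, Z k ω) 2 μ := memLp_finsetSum a fun k _ => hZ k
  have hmean : ∫ ω, ∑ k ∈ a, Z k ω ∂μ = ∑ k ∈ a, ∫ ω', Z k ω' ∂μ :=
    integral_finsetSum a fun k _ => (hZ k).integrable (by norm_num)
  have h := evariance_eq_lintegral_ofReal (fun ω => ∑ k ∈ a, Z k ω) μ
  rw [← ofReal_variance hm, hmean] at h
  rw [← h]
  refine ENNReal.ofReal_le_ofReal ?_
  rw [variance_fun_sum' fun k _ => hZ k]
  exact (Finset.sum_le_sum fun k _ => Finset.sum_le_sum fun k' _ => le_abs_self _).trans hB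

/-- The expected total sum is finite, hence the sum is finite almost surely and its terms vanish
along the cofinite filter. This plays the role of Borel–Cantelli. -/
theorem ae_tendsto_cofinite_of_summable {ι : Type*} [Countable ι] (f : ι → Ω → ℝ)
    (hf : ∀ i, Measurable (f i)) (hf0 : ∀ i ω, 0 ≤ f i ω) (b : ι → ℝ) (hb0 : ∀ i, 0 ≤ b i)
    (hb : Summable b) (h : ∀ i, ∫⁻ ω, ENNReal.ofReal (f i ω) ∂μ ≤ ENNReal.ofReal (b i)) :
    ∀ᵐ ω ∂μ, Tendsto (fun i => f i ω) cofinite (𝓝 0) := by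
  have h1 : ∫⁻ ω, ∑' i, ENNReal.ofReal (f i ω) ∂μ ≠ ⊤ := by
    rw [lintegral_tsum fun i => (hf i).ennreal_ofReal.aemeasurable]
    refine ne_top_of_le_ne_top ?_ (ENNReal.tsum_le_tsum h)
    rw [← ENNReal.ofReal_tsum_of_nonneg hb0 hb]
    exact ENNReal.ofReal_ne_top
  filter_upwards [ae_lt_top (Measurable.tsum fun i => (hf i).ennreal_ofReal) h1] with ω hω
  have h2 := ENNReal.tendsto_cofinite_zero_of_tsum_ne_top hω.ne
  have h3 := (ENNReal.tendsto_toReal ENNReal.zero_ne_top).comp h2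
  refine h3.congr fun i => ?_
  simp [ENNReal.toReal_ofReal (hf0 i ω)]

/-! ### The noise -/

/-- The quadratic form of `∑ E_t E_t'`. -/
noncomputable def noiseForm (e : ℕ → ℕ → ℕ → Ω → ℝ) (p1 p2 T : ℕ) (ω : Ω) (v : ℕ → ℝ) : ℝ :=
  ∑ k ∈ Finset.range T ×ˢ Finset.range p2, (∑ i ∈ Finset.range p1, v i * e i k.2 k.1 ω) ^ 2

/-- The squared Frobenius norm of `∑ E_t E_t'` minus its expectation. -/
noncomputable def devRow (μ : Measure Ω) (e : ℕ → ℕ → ℕ → Ω → ℝ) (p1 p2 T : ℕ) (ω : Ω) : ℝ :=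
  ∑ i ∈ Finset.range p1, ∑ l ∈ Finset.range p1,
    (∑ k ∈ Finset.range T ×ˢ Finset.range p2, e i k.2 k.1 ω * e l k.2 k.1 ω
      - ∑ k ∈ Finset.range T ×ˢ Finset.range p2, ∫ ω', e i k.2 k.1 ω' * e l k.2 k.1 ω' ∂μ) ^ 2

/-- The squared Frobenius norm of `E_t' E_t` minus its expectation. -/
noncomputable def devCol (μ : Measure Ω) (e : ℕ → ℕ → ℕ → Ω → ℝ) (p1 p2 t : ℕ) (ω : Ω) : ℝ :=
  ∑ j ∈ Finset.range p2, ∑ h ∈ Finset.range p2,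
    (∑ i ∈ Finset.range p1, e i j t ω * e i h t ω
      - ∑ i ∈ Finset.range p1, ∫ ω', e i j t ω' * e i h t ω' ∂μ) ^ 2

theorem devRow_nonneg (e : ℕ → ℕ → ℕ → Ω → ℝ) (p1 p2 T : ℕ) (ω : Ω) :
    0 ≤ devRow μ e p1 p2 T ω :=
  Finset.sum_nonneg fun _ _ => Finset.sum_nonneg fun _ _ => sq_nonneg _

theorem devCol_nonneg (e : ℕ → ℕ → ℕ → Ω → ℝ) (p1 p2 t : ℕ) (ω : Ω) :
    0 ≤ devCol μ e p1 p2 t ω :=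
  Finset.sum_nonneg fun _ _ => Finset.sum_nonneg fun _ _ => sq_nonneg _

theorem measurable_devRow {e : ℕ → ℕ → ℕ → Ω → ℝ} (he : ∀ i j t, Measurable (e i j t))
    (p1 p2 T : ℕ) : Measurable (devRow μ e p1 p2 T) := by
  unfold devRow
  fun_prop

theorem measurable_devCol {e : ℕ → ℕ → ℕ → Ω → ℝ} (he : ∀ i j t, Measurable (e i j t))
    (p1 p2 t : ℕ) : Measurable (devCol μ e p1 p2 t) := by
  unfold devCol
  fun_prop

theorem AssumptionB3.memLp_mul [IsProbabilityMeasure μ] {e : ℕ → ℕ → ℕ → Ω → ℝ}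
    (hB3 : AssumptionB3 μ e) (he : ∀ i j t, Measurable (e i j t)) (i j t l h s : ℕ) :
    MemLp (fun ω => e i j t ω * e l h s ω) 2 μ := by
  obtain ⟨c, hc⟩ := hB3.moment
  have h4 : ∀ i j t, MemLp (e i j t) 4 μ := by
    intro i j t
    have h8 : MemLp (e i j t) 8 μ := by
      refine ⟨(he i j t).aestronglyMeasurable, ?_⟩
      rw [eLpNorm_lt_top_iff_lintegral_rpow_enorm_lt_top (by norm_num) (by norm_num)]
      refine lt_of_le_of_lt (lintegral_mono fun ω => ?_)
        ((hc i j t).trans_lt ENNReal.ofReal_lt_top)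
      rw [ENNReal.toReal_ofNat, show (8 : ℝ) = ((8 : ℕ) : ℝ) by norm_num, ENNReal.rpow_natCast,
        Real.enorm_eq_ofReal_abs, ← ENNReal.ofReal_pow (abs_nonneg _), Even.pow_abs (by decide)]
    exact h8.mono_exponent (by norm_num)
  have : ENNReal.HolderTriple 4 4 2 := ⟨by
    rw [← two_mul, show (4 : ENNReal) = 2 * 2 by norm_num,
      ENNReal.mul_inv (by simp) (by simp), ← mul_assoc, ENNReal.mul_inv_cancel (by simp) (by simp),
      one_mul]⟩
  exact (h4 l h s).mul (h4 i j t)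

/-- Each of the p1² entries is a variance of a sum of p2 T products, and `cov_a_row` bounds the
covariances of one product with all the others by c. -/
theorem AssumptionB3.lintegral_devRow_le [IsProbabilityMeasure μ] {e : ℕ → ℕ → ℕ → Ω → ℝ}
    (hB3 : AssumptionB3 μ e) (he : ∀ i j t, Measurable (e i j t)) : ∃ c : ℝ, 0 ≤ c ∧ ∀ p1 p2 T,
    ∫⁻ ω, ENNReal.ofReal (devRow μ e p1 p2 T ω) ∂μ ≤
      ENNReal.ofReal (c * ((p1 : ℝ) ^ 2 * (p2 * T))) := by
  obtain ⟨c, hc⟩ := hB3.cov_a_row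
  have hc0 : 0 ≤ c := le_trans (by positivity) (hc 1 1 1 0 0 0 0 one_pos one_pos one_pos one_pos)
  refine ⟨c, hc0, fun p1 p2 T => ?_⟩
  have key : ∀ i ∈ Finset.range p1, ∀ l ∈ Finset.range p1, ∫⁻ ω, ENNReal.ofReal
      ((∑ k ∈ Finset.range T ×ˢ Finset.range p2, e i k.2 k.1 ω * e l k.2 k.1 ω
      - ∑ k ∈ Finset.range T ×ˢ Finset.range p2,
        ∫ ω', e i k.2 k.1 ω' * e l k.2 k.1 ω' ∂μ) ^ 2) ∂μ ≤ ENNReal.ofReal (c * (p2 * T)) := by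
    intro i hi l hl
    refine lintegral_sum_sub_sq_le _ (fun (k : ℕ × ℕ) ω => e i k.2 k.1 ω * e l k.2 k.1 ω)
      (fun k => hB3.memLp_mul he _ _ _ _ _ _) ?_
    calc _ ≤ ∑ k ∈ Finset.range T ×ˢ Finset.range p2, c := by
          refine Finset.sum_le_sum fun k hk => ?_
          rw [Finset.mem_product, Finset.mem_range, Finset.mem_range] at hk
          rw [Finset.mem_range] at hi hl
          refine le_trans ?_ (hc p1 p2 T i k.2 k.1 l hi hk.2 hk.1 hl)
          rw [Finset.sum_product]
          refine Finset.sum_le_sum fun s _ => ?_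
          -- Only the term l2 = l of the assumed sum is needed.
          exact Finset.single_le_sum (f := fun l2 => ∑ h ∈ Finset.range p2,
            |cov[fun ω => e i k.2 k.1 ω * e l k.2 k.1 ω, fun ω => e i h s ω * e l2 h s ω; μ]|)
            (fun l2 _ => Finset.sum_nonneg fun h _ => abs_nonneg _) (Finset.mem_range.2 hl)
      _ = c * (p2 * T) := by
          simp
          ring
  have e1 : ∀ ω, ENNReal.ofReal (devRow μ e p1 p2 T ω) =
      ∑ i ∈ Finset.range p1, ∑ l ∈ Finset.range p1, ENNReal.ofReal
      ((∑ k ∈ Finset.range T ×ˢ Finset.range p2, e i k.2 k.1 ω * e l k.2 k.1 ω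
      - ∑ k ∈ Finset.range T ×ˢ Finset.range p2,
        ∫ ω', e i k.2 k.1 ω' * e l k.2 k.1 ω' ∂μ) ^ 2) := by
    intro ω
    rw [devRow, ENNReal.ofReal_sum_of_nonneg
      fun _ _ => Finset.sum_nonneg fun _ _ => sq_nonneg _]
    exact Finset.sum_congr rfl fun i _ => ENNReal.ofReal_sum_of_nonneg fun _ _ => sq_nonneg _
  simp_rw [e1]
  rw [lintegral_finsetSum _ fun i _ => by fun_prop]
  calc _ ≤ ∑ i ∈ Finset.range p1, ∑ l ∈ Finset.range p1, ENNReal.ofReal (c * (p2 * T)) := by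
        refine Finset.sum_le_sum fun i hi => ?_
        rw [lintegral_finsetSum _ fun i _ => by fun_prop]
        exact Finset.sum_le_sum fun l hl => key i hi l hl
    _ = _ := by
        rw [← ENNReal.ofReal_sum_of_nonneg fun _ _ => by positivity,
          ← ENNReal.ofReal_sum_of_nonneg fun _ _ => by positivity]
        congr 1
        simp
        ring

theorem AssumptionB3.lintegral_devCol_le [IsProbabilityMeasure μ] {e : ℕ → ℕ → ℕ → Ω → ℝ}
    (hB3 : AssumptionB3 μ e) (he : ∀ i j t, Measurable (e i j t)) : ∃ c : ℝ, 0 ≤ c ∧ ∀ p1 p2 t,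
    ∫⁻ ω, ENNReal.ofReal (devCol μ e p1 p2 t ω) ∂μ ≤
      ENNReal.ofReal (c * ((p2 : ℝ) ^ 2 * p1)) := by
  obtain ⟨c, hc⟩ := hB3.cov_a_col
  have hc0 : 0 ≤ c := le_trans (by positivity) (hc 1 1 1 0 0 0 0 one_pos one_pos one_pos one_pos)
  refine ⟨c, hc0, fun p1 p2 t => ?_⟩
  have key : ∀ j ∈ Finset.range p2, ∀ h ∈ Finset.range p2, ∫⁻ ω, ENNReal.ofReal
      ((∑ i ∈ Finset.range p1, e i j t ω * e i h t ω
      - ∑ i ∈ Finset.range p1, ∫ ω', e i j t ω' * e i h t ω' ∂μ) ^ 2) ∂μ ≤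
        ENNReal.ofReal (c * p1) := by
    intro j hj h hh
    refine lintegral_sum_sub_sq_le _ (fun i ω => e i j t ω * e i h t ω)
      (fun k => hB3.memLp_mul he _ _ _ _ _ _) ?_
    calc _ ≤ ∑ i ∈ Finset.range p1, c := by
          refine Finset.sum_le_sum fun i hi => ?_
          rw [Finset.mem_range] at hi hj hh
          -- Sample size t + 1 is the smallest containing time t; the terms s = t and h2 = h are
          -- kept.
          refine le_trans ?_ (hc p1 p2 (t + 1) i j t h hi hj (Nat.lt_succ_self t) hh)
          refine le_trans ?_ (Finset.single_le_sum (f := fun s => ∑ l ∈ Finset.range p1,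
            ∑ h2 ∈ Finset.range p2, |cov[fun ω => e i j t ω * e i h t ω,
              fun ω => e l j s ω * e l h2 s ω; μ]|)
            (fun s _ => Finset.sum_nonneg fun l _ => Finset.sum_nonneg fun h _ => abs_nonneg _)
            (Finset.self_mem_range_succ t))
          refine Finset.sum_le_sum fun l _ => ?_
          exact Finset.single_le_sum (f := fun h2 => |cov[fun ω => e i j t ω * e i h t ω,
              fun ω => e l j t ω * e l h2 t ω; μ]|)
            (fun h _ => abs_nonneg _) (Finset.mem_range.2 hh)
      _ = c * p1 := by
          simp
          ring
  have e1 : ∀ ω, ENNReal.ofReal (devCol μ e p1 p2 t ω) =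
      ∑ j ∈ Finset.range p2, ∑ h ∈ Finset.range p2, ENNReal.ofReal
      ((∑ i ∈ Finset.range p1, e i j t ω * e i h t ω
      - ∑ i ∈ Finset.range p1, ∫ ω', e i j t ω' * e i h t ω' ∂μ) ^ 2) := by
    intro ω
    rw [devCol, ENNReal.ofReal_sum_of_nonneg
      fun _ _ => Finset.sum_nonneg fun _ _ => sq_nonneg _]
    exact Finset.sum_congr rfl fun i _ => ENNReal.ofReal_sum_of_nonneg fun _ _ => sq_nonneg _
  simp_rw [e1]
  rw [lintegral_finsetSum _ fun i _ => by fun_prop]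
  calc _ ≤ ∑ i ∈ Finset.range p2, ∑ l ∈ Finset.range p2, ENNReal.ofReal (c * p1) := by
        refine Finset.sum_le_sum fun i hi => ?_
        rw [lintegral_finsetSum _ fun i _ => by fun_prop]
        exact Finset.sum_le_sum fun l hl => key i hi l hl
    _ = _ := by
        rw [← ENNReal.ofReal_sum_of_nonneg fun _ _ => by positivity,
          ← ENNReal.ofReal_sum_of_nonneg fun _ _ => by positivity]
        congr 1
        simp
        ring

/-- The first bound treats ∑ E_t E_t' as one p1 × p1 matrix. The second bounds each p2 × p2 matrix
E_t' E_t, which has the same norm as E_t E_t', and adds over t. -/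
theorem AssumptionB3.noiseForm_le {e : ℕ → ℕ → ℕ → Ω → ℝ} (hB3 : AssumptionB3 μ e) :
    ∃ c : ℝ, 0 ≤ c ∧ ∀ p1 p2 T ω v,
      noiseForm e p1 p2 T ω v ≤
        (c * (p2 * T) + √(devRow μ e p1 p2 T ω)) * ∑ i ∈ Finset.range p1, v i ^ 2 ∧
      noiseForm e p1 p2 T ω v ≤
        (c * (p1 * T) + √(T * ∑ t ∈ Finset.range T, devCol μ e p1 p2 t ω)) *
          ∑ i ∈ Finset.range p1, v i ^ 2 := by
  obtain ⟨c, hc⟩ := hB3.dep_a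
  have hc0 : 0 ≤ c := le_trans (by positivity) (hc 1 1 1 0 0 0 one_pos one_pos one_pos)
  refine ⟨c, hc0, fun p1 p2 T ω v => ⟨?_, ?_⟩⟩
  · refine sum_sq_le_of_rowSum_le _ _ (fun (k : ℕ × ℕ) i => e i k.2 k.1 ω)
      (fun i l => ∑ k ∈ Finset.range T ×ˢ Finset.range p2,
        ∫ ω', e i k.2 k.1 ω' * e l k.2 k.1 ω' ∂μ) (fun i l => ?_) (fun i hi => ?_) v
    · simp only [mul_comm]
    · calc _ ≤ ∑ l ∈ Finset.range p1, ∑ k ∈ Finset.range T ×ˢ Finset.range p2,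
            |∫ ω', e i k.2 k.1 ω' * e l k.2 k.1 ω' ∂μ| :=
            Finset.sum_le_sum fun l _ => Finset.abs_sum_le_sum_abs _ _
        _ = ∑ k ∈ Finset.range T ×ˢ Finset.range p2, ∑ l ∈ Finset.range p1,
            |∫ ω', e i k.2 k.1 ω' * e l k.2 k.1 ω' ∂μ| := Finset.sum_comm
        _ ≤ ∑ k ∈ Finset.range T ×ˢ Finset.range p2, c := by
            refine Finset.sum_le_sum fun k hk => ?_
            rw [Finset.mem_product, Finset.mem_range, Finset.mem_range] at hk
            refine le_trans ?_ (hc p1 p2 T i k.2 k.1 (Finset.mem_range.1 hi) hk.2 hk.1)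
            refine le_trans ?_ (Finset.single_le_sum (f := fun s => ∑ l ∈ Finset.range p1,
              ∑ h ∈ Finset.range p2, |∫ ω, e i k.2 k.1 ω * e l h s ω ∂μ|)
              (fun s _ => Finset.sum_nonneg fun l _ => Finset.sum_nonneg fun h _ => abs_nonneg _)
              (Finset.mem_range.2 hk.1))
            refine Finset.sum_le_sum fun l _ => ?_
            exact Finset.single_le_sum (f := fun h => |∫ ω, e i k.2 k.1 ω * e l h k.1 ω ∂μ|)
              (fun h _ => abs_nonneg _) (Finset.mem_range.2 hk.2)
        _ = c * (p2 * T) := by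
          simp
          ring
  · have key : ∀ t ∈ Finset.range T, ∑ j ∈ Finset.range p2,
        (∑ i ∈ Finset.range p1, v i * e i j t ω) ^ 2 ≤
          (c * p1 + √(devCol μ e p1 p2 t ω)) * ∑ i ∈ Finset.range p1, v i ^ 2 := by
      intro t _
      refine sum_sq_le_of_dual _ _ (fun j i => e i j t ω) (by positivity) (fun y => ?_) v
      refine sum_sq_le_of_rowSum_le _ _ (fun i j => e i j t ω)
        (fun j h => ∑ i ∈ Finset.range p1, ∫ ω', e i j t ω' * e i h t ω' ∂μ)
        (fun j h => ?_) (fun j hj => ?_) y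
      · simp only [mul_comm]
      · calc _ ≤ ∑ h ∈ Finset.range p2, ∑ i ∈ Finset.range p1,
              |∫ ω', e i j t ω' * e i h t ω' ∂μ| :=
              Finset.sum_le_sum fun l _ => Finset.abs_sum_le_sum_abs _ _
          _ = ∑ i ∈ Finset.range p1, ∑ h ∈ Finset.range p2,
              |∫ ω', e i j t ω' * e i h t ω' ∂μ| := Finset.sum_comm
          _ ≤ ∑ i ∈ Finset.range p1, c := by
              refine Finset.sum_le_sum fun i hi => ?_
              refine le_trans ?_ (hc p1 p2 (t + 1) i j t (Finset.mem_range.1 hi)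
                (Finset.mem_range.1 hj) (Nat.lt_succ_self t))
              refine le_trans ?_ (Finset.single_le_sum (f := fun s => ∑ l ∈ Finset.range p1,
                ∑ h ∈ Finset.range p2, |∫ ω, e i j t ω * e l h s ω ∂μ|)
                (fun s _ => Finset.sum_nonneg fun l _ => Finset.sum_nonneg fun h _ =>
                  abs_nonneg _) (Finset.self_mem_range_succ t))
              exact Finset.single_le_sum (f := fun l => ∑ h ∈ Finset.range p2,
                |∫ ω, e i j t ω * e l h t ω ∂μ|)
                (fun l _ => Finset.sum_nonneg fun h _ => abs_nonneg _) hi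
          _ = c * p1 := by
            simp
            ring
    -- Cauchy–Schwarz over the T times.
    have hcs : ∑ t ∈ Finset.range T, √(devCol μ e p1 p2 t ω) ≤
        √(T * ∑ t ∈ Finset.range T, devCol μ e p1 p2 t ω) := by
      refine Real.le_sqrt_of_sq_le ?_
      have h := sq_sum_le_card_mul_sum_sq (s := Finset.range T)
        (f := fun t => √(devCol μ e p1 p2 t ω))
      simpa [Real.sq_sqrt (devCol_nonneg e p1 p2 _ ω)] using h
    rw [noiseForm, Finset.sum_product]
    refine (Finset.sum_le_sum key).trans ?_
    rw [← Finset.sum_mul]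
    refine mul_le_mul_of_nonneg_right ?_ (Finset.sum_nonneg fun i _ => sq_nonneg _)
    rw [Finset.sum_add_distrib, Finset.sum_const, Finset.card_range, nsmul_eq_mul]
    nlinarith

/-- Extend v by zero; the additional squares are nonnegative. A bound at the upper corner of a
dyadic block thus serves the whole block. -/
theorem noiseForm_le_of_le {Ω : Type*} {e : ℕ → ℕ → ℕ → Ω → ℝ} {p1 p2 T P1 P2 T' : ℕ} (h1 : p1 ≤ P1)
    (h2 : p2 ≤ P2) (h3 : T ≤ T') {ω : Ω} {B : ℝ}
    (h : ∀ v, noiseForm e P1 P2 T' ω v ≤ B * ∑ i ∈ Finset.range P1, v i ^ 2) (v : ℕ → ℝ) :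
    noiseForm e p1 p2 T ω v ≤ B * ∑ i ∈ Finset.range p1, v i ^ 2 := by
  have hsub : Finset.range p1 ⊆ Finset.range P1 := Finset.range_subset_range.2 h1
  have hw := h (fun i => if i ∈ Finset.range p1 then v i else 0)
  have e1 : ∑ i ∈ Finset.range P1, (if i ∈ Finset.range p1 then v i else 0) ^ 2 =
      ∑ i ∈ Finset.range p1, v i ^ 2 := by
    simp_rw [ite_pow, zero_pow two_ne_zero]
    rw [Finset.sum_ite_mem, Finset.inter_eq_right.2 hsub]
  have e2 : ∀ j t, ∑ i ∈ Finset.range P1, (if i ∈ Finset.range p1 then v i else 0) * e i j t ω =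
      ∑ i ∈ Finset.range p1, v i * e i j t ω := by
    intro j t
    simp_rw [ite_mul, zero_mul]
    rw [Finset.sum_ite_mem, Finset.inter_eq_right.2 hsub]
  rw [e1] at hw
  refine le_trans ?_ hw
  simp only [noiseForm, e2]
  exact Finset.sum_le_sum_of_subset_of_nonneg (Finset.product_subset_product
    (Finset.range_subset_range.2 h3) (Finset.range_subset_range.2 h2)) fun _ _ _ => sq_nonneg _

end MatrixFactor

namespace MatrixFactor

/-! ### Limits as the smallest dimension grows, and dyadic blocks -/

/-- `min p1 p2 T → ∞`. -/
abbrev minAtTop : Filter (ℕ × ℕ × ℕ) :=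
  comap (fun q : ℕ × ℕ × ℕ => min q.1 (min q.2.1 q.2.2)) atTop

theorem tendsto_fst_minAtTop : Tendsto (fun q : ℕ × ℕ × ℕ => q.1) minAtTop atTop :=
  tendsto_atTop_mono (fun _ => min_le_left _ _) tendsto_comap

theorem tendsto_snd_minAtTop : Tendsto (fun q : ℕ × ℕ × ℕ => q.2.1) minAtTop atTop :=
  tendsto_atTop_mono (fun _ => (min_le_right _ _).trans (min_le_left _ _)) tendsto_comap

theorem tendsto_thd_minAtTop : Tendsto (fun q : ℕ × ℕ × ℕ => q.2.2) minAtTop atTop :=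
  tendsto_atTop_mono (fun _ => (min_le_right _ _).trans (min_le_right _ _)) tendsto_comap

/-- The index of the dyadic block of a triple. -/
def block (q : ℕ × ℕ × ℕ) : ℕ × ℕ × ℕ := (Nat.log 2 q.1, Nat.log 2 q.2.1, Nat.log 2 q.2.2)

/-- A finite set of blocks has bounded first index, so p1 → ∞ alone leaves it. -/
theorem tendsto_block : Tendsto block minAtTop cofinite := by
  intro s hs
  rw [mem_cofinite] at hs
  obtain ⟨M, hM⟩ := (hs.image Prod.fst).bddAbove
  rw [mem_map]
  filter_upwards [tendsto_fst_minAtTop.eventually_ge_atTop (2 ^ (M + 1))] with q hq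
  by_contra hc
  have h1 : Nat.log 2 q.1 ≤ M := hM ⟨block q, hc, rfl⟩
  have h2 : M + 1 ≤ Nat.log 2 q.1 := Nat.le_log_of_pow_le (by norm_num) hq
  omega

theorem le_two_pow_log_succ (n : ℕ) : n ≤ 2 ^ (Nat.log 2 n + 1) :=
  (Nat.lt_pow_succ_log_self (by norm_num) n).le

theorem two_pow_log_succ_le {n : ℕ} (hn : n ≠ 0) : (2 : ℝ) ^ (Nat.log 2 n + 1) ≤ 2 * n := by
  have h := Nat.pow_log_le_self 2 hn
  rw [pow_succ, mul_comm]
  have : ((2 ^ Nat.log 2 n : ℕ) : ℝ) ≤ n := by exact_mod_cast h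
  push_cast at this
  linarith

/-- The halving comes from m ≥ (m + 1) / 2 for the dyadic exponent m ≥ 1. -/
theorem log_succ_le_log {n : ℕ} (hn : 2 ≤ n) :
    Real.log 2 / 2 * ((Nat.log 2 n : ℝ) + 1) ≤ Real.log n := by
  have h1 : 1 ≤ Nat.log 2 n := Nat.le_log_of_pow_le (by norm_num) (by simpa using hn)
  have h2 : (Nat.log 2 n : ℝ) * Real.log 2 ≤ Real.log n := by
    rw [← Real.log_pow]
    refine Real.log_le_log (by positivity) ?_
    exact_mod_cast Nat.pow_log_le_self 2 (by omega)
  have h3 : (1 : ℝ) ≤ Nat.log 2 n := by exact_mod_cast h1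
  nlinarith [Real.log_pos (by norm_num : (1 : ℝ) < 2)]

theorem summable_triple {f g h : ℕ → ℝ} (hf : Summable f) (hg : Summable g) (hh : Summable h)
    (hf0 : ∀ n, 0 ≤ f n) (hg0 : ∀ n, 0 ≤ g n) (hh0 : ∀ n, 0 ≤ h n) :
    Summable fun m : ℕ × ℕ × ℕ => f m.1 * (g m.2.1 * h m.2.2) :=
  hf.mul_of_nonneg (hg.mul_of_nonneg hh hg0 hh0) hf0 fun _ => mul_nonneg (hg0 _) (hh0 _)

/-! ### Almost sure bounds for the noise -/

variable {Ω : Type*} [MeasurableSpace Ω] {μ : Measure Ω} [IsProbabilityMeasure μ]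

/-- The logarithmic factor of the dyadic block `m`. -/
noncomputable def blockLog (ε : ℝ) (m : ℕ × ℕ × ℕ) : ℝ :=
  ((((m.1 : ℝ) + 1) ^ 2 * (m.2.1 + 1)) * (m.2.2 + 1)) ^ (1 + 2 * ε)

theorem blockLog_pos (ε : ℝ) (m : ℕ × ℕ × ℕ) : 0 < blockLog ε m := by
  unfold blockLog
  positivity

/-- The sum factors into three series with exponents 2 + 4ε, 1 + 2ε and 1 + 2ε. -/
theorem summable_inv_blockLog {ε : ℝ} (hε : 0 < ε) : Summable fun m => (blockLog ε m)⁻¹ := by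
  have hs : ∀ r : ℝ, 1 < r → Summable fun n : ℕ => (((n : ℝ) + 1) ^ r)⁻¹ := by
    intro r hr
    have h := (summable_nat_add_iff 1).2 (Real.summable_nat_rpow_inv.2 hr)
    simpa using h
  refine (summable_triple (hs (2 * (1 + 2 * ε)) (by linarith)) (hs (1 + 2 * ε) (by linarith))
    (hs (1 + 2 * ε) (by linarith)) (fun n => by positivity) (fun n => by positivity)
    (fun n => by positivity)).congr fun m => ?_
  rw [blockLog, Real.mul_rpow (by positivity) (by positivity),
    Real.mul_rpow (by positivity) (by positivity), mul_inv, mul_inv, mul_assoc,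
    Real.rpow_mul (by positivity), Real.rpow_two]

/-- Squaring the rate turns the exponent 1/2 + ε into the 1 + 2ε of `blockLog`. The four logarithms,
counted with multiplicity, each lose a factor log 2 / 2. -/
theorem sq_rate_ge {ε : ℝ} (hε : 0 < ε) {p1 p2 T : ℕ} (h1 : 2 ≤ p1) (h2 : 2 ≤ p2) (h3 : 2 ≤ T) :
    ((Real.log 2 / 2) ^ 4) ^ (1 + 2 * ε) * blockLog ε (block (p1, p2, T)) * (p1 : ℝ) ^ 2 ≤
      rate ε p1 p2 T ^ 2 * (p2 * T) := by
  have hl : 0 < Real.log 2 := Real.log_pos (by norm_num)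
  have hp2 : (0 : ℝ) < p2 := by positivity
  have hT : (0 : ℝ) < T := by positivity
  have hL : 0 ≤ Real.log p1 ^ 2 * Real.log p2 * Real.log T :=
    mul_nonneg (mul_nonneg (sq_nonneg _) (Real.log_natCast_nonneg _)) (Real.log_natCast_nonneg _)
  have e : rate ε p1 p2 T ^ 2 * (p2 * T) =
      (Real.log p1 ^ 2 * Real.log p2 * Real.log T) ^ (1 + 2 * ε) * (p1 : ℝ) ^ 2 := by
    rw [rate, mul_pow, div_pow, Real.sq_sqrt (by positivity),
      ← Real.rpow_natCast ((Real.log p1 ^ 2 * Real.log p2 * Real.log T) ^ (1 / 2 + ε)),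
      ← Real.rpow_mul hL]
    rw [show (1 / 2 + ε) * ((2 : ℕ) : ℝ) = 1 + 2 * ε by push_cast; ring]
    field_simp
  rw [e]
  refine mul_le_mul_of_nonneg_right ?_ (sq_nonneg _)
  rw [blockLog, ← Real.mul_rpow (by positivity) (by positivity)]
  refine Real.rpow_le_rpow (by positivity) ?_ (by linarith)
  simp only [block]
  calc _ = (Real.log 2 / 2 * ((Nat.log 2 p1 : ℝ) + 1)) ^ 2 *
      (Real.log 2 / 2 * ((Nat.log 2 p2 : ℝ) + 1)) * (Real.log 2 / 2 * ((Nat.log 2 T : ℝ) + 1)) := by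
        ring
    _ ≤ _ := by
      have := log_succ_le_log h1
      have := log_succ_le_log h2
      have := log_succ_le_log h3
      have := Real.log_natCast_nonneg p2
      gcongr

/-- The largest eigenvalue of `(T p2)⁻¹ ∑ E_t E_t'` is bounded up to `o(rate)`. -/
theorem AssumptionB3.ae_noiseForm_le_rate {e : ℕ → ℕ → ℕ → Ω → ℝ} (hB3 : AssumptionB3 μ e)
    (he : ∀ i j t, Measurable (e i j t)) : ∃ c : ℝ, ∀ ε : ℝ, 0 < ε → ∀ᵐ ω ∂μ, ∀ δ : ℝ, 0 < δ →
    ∀ᶠ q in minAtTop, ∀ v, noiseForm e q.1 q.2.1 q.2.2 ω v ≤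
      (c + δ * rate ε q.1 q.2.1 q.2.2) * (q.2.1 * q.2.2) * ∑ i ∈ Finset.range q.1, v i ^ 2 := by
  obtain ⟨c, hc0, hc⟩ := hB3.noiseForm_le
  obtain ⟨C, hC0, hC⟩ := hB3.lintegral_devRow_le he
  -- Passing to the upper corner at most doubles p2 and T, hence the 4.
  refine ⟨4 * c, fun ε hε => ?_⟩
  have hae := ae_tendsto_cofinite_of_summable (μ := μ)
    (fun (m : ℕ × ℕ × ℕ) ω => ((2 ^ (m.1 + 1)) ^ 2 * (2 ^ (m.2.1 + 1) * 2 ^ (m.2.2 + 1)) *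
      blockLog ε m)⁻¹ * devRow μ e (2 ^ (m.1 + 1)) (2 ^ (m.2.1 + 1)) (2 ^ (m.2.2 + 1)) ω)
    (fun m => (measurable_devRow he _ _ _).const_mul _)
    (fun m ω => mul_nonneg (by have := blockLog_pos ε m; positivity) (devRow_nonneg _ _ _ _ _))
    (fun m => C * (blockLog ε m)⁻¹) (fun m => by have := blockLog_pos ε m; positivity)
    ((summable_inv_blockLog hε).mul_left C) (fun m => by
      have hb := blockLog_pos ε m
      simp_rw [ENNReal.ofReal_mul (p := ((2 ^ (m.1 + 1)) ^ 2 *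
        (2 ^ (m.2.1 + 1) * 2 ^ (m.2.2 + 1)) * blockLog ε m)⁻¹) (by positivity)]
      rw [lintegral_const_mul _ (measurable_devRow he _ _ _).ennreal_ofReal]
      refine (mul_le_mul_right (hC _ _ _) _).trans (le_of_eq ?_)
      rw [← ENNReal.ofReal_mul (by positivity)]
      congr 1
      push_cast
      field_simp)
  filter_upwards [hae] with ω hω δ hδ
  set κ : ℝ := ((Real.log 2 / 2) ^ 4) ^ (1 + 2 * ε) with hκ
  have hκ0 : 0 < κ := by
    have hl : 0 < Real.log 2 := Real.log_pos (by norm_num)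
    positivity
  -- The 16 pays for the growth of p1² p2 T on passing to the corner.
  have hlim := (hω.comp tendsto_block).eventually_lt_const
    (show (0 : ℝ) < δ ^ 2 * κ / 16 by positivity)
  filter_upwards [hlim, tendsto_fst_minAtTop.eventually_ge_atTop 2,
    tendsto_snd_minAtTop.eventually_ge_atTop 2, tendsto_thd_minAtTop.eventually_ge_atTop 2]
    with q hq h1 h2 h3 v
  obtain ⟨p1, p2, T⟩ := q
  simp only [Function.comp_apply] at hq h1 h2 h3 ⊢
  set m := block (p1, p2, T) with hm
  have hb := blockLog_pos ε m
  have hP1 := two_pow_log_succ_le (n := p1) (by omega)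
  have hP2 := two_pow_log_succ_le (n := p2) (by omega)
  have hP3 := two_pow_log_succ_le (n := T) (by omega)
  refine noiseForm_le_of_le (le_two_pow_log_succ p1) (le_two_pow_log_succ p2)
    (le_two_pow_log_succ T) (fun w => ?_) v
  refine (hc _ _ _ _ _).1.trans (mul_le_mul_of_nonneg_right ?_
    (Finset.sum_nonneg fun i _ => sq_nonneg _))
  have hr0 : 0 ≤ rate ε p1 p2 T := by
    unfold rate
    have hL : 0 ≤ Real.log p1 ^ 2 * Real.log p2 * Real.log T :=
      mul_nonneg (mul_nonneg (sq_nonneg _) (Real.log_natCast_nonneg _))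
        (Real.log_natCast_nonneg _)
    positivity
  have hsq : √(devRow μ e (2 ^ (Nat.log 2 p1 + 1)) (2 ^ (Nat.log 2 p2 + 1))
      (2 ^ (Nat.log 2 T + 1)) ω) ≤ δ * rate ε p1 p2 T * (p2 * T) := by
    refine Real.sqrt_le_iff.2 ⟨by positivity, ?_⟩
    rw [inv_mul_lt_iff₀ (by positivity)] at hq
    refine hq.le.trans ?_
    simp only [hm, block]
    have hs := sq_rate_ge hε h1 h2 h3
    calc _ ≤ (2 * (p1 : ℝ)) ^ 2 * ((2 * p2) * (2 * T)) * blockLog ε (block (p1, p2, T)) *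
          (δ ^ 2 * κ / 16) := by
          simp only [block] at hb ⊢
          gcongr
      _ = δ ^ 2 * (p2 * T) * (κ * blockLog ε (block (p1, p2, T)) * (p1 : ℝ) ^ 2) := by ring
      _ ≤ δ ^ 2 * (p2 * T) * (rate ε p1 p2 T ^ 2 * (p2 * T)) := by gcongr
      _ = _ := by ring
  calc _ ≤ c * ((2 * p2) * (2 * T)) + δ * rate ε p1 p2 T * (p2 * T) := by
        push_cast
        gcongr
    _ = _ := by ring

theorem sq_inv_sqrt_two_pow (n : ℕ) : (((√2)⁻¹ : ℝ) ^ n) ^ 2 = ((2 : ℝ) ^ n)⁻¹ := by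
  rw [← pow_mul, mul_comm, pow_mul, inv_pow, Real.sq_sqrt (by norm_num), inv_pow]

/-- The largest eigenvalue of `(T p2)⁻¹ ∑ E_t E_t'` is `o(p1)`. -/
theorem AssumptionB3.ae_noiseForm_le_dim {e : ℕ → ℕ → ℕ → Ω → ℝ} (hB3 : AssumptionB3 μ e)
    (he : ∀ i j t, Measurable (e i j t)) : ∀ᵐ ω ∂μ, ∀ η : ℝ, 0 < η →
    ∀ᶠ q in minAtTop, ∀ v, noiseForm e q.1 q.2.1 q.2.2 ω v ≤
      η * q.1 * (q.2.1 * q.2.2) * ∑ i ∈ Finset.range q.1, v i ^ 2 := by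
  obtain ⟨c, hc0, hc⟩ := hB3.noiseForm_le
  obtain ⟨C, hC0, hC⟩ := hB3.lintegral_devRow_le he
  obtain ⟨D, hD0, hD⟩ := hB3.lintegral_devCol_le he
  set K := max C D with hK
  have hK0 : 0 ≤ K := le_max_of_le_left hC0
  -- The smaller of the two squared deviations at the corner, relative to (p1 p2 T)².
  let f : ℕ × ℕ × ℕ → Ω → ℝ := fun m ω =>
    (((2 : ℝ) ^ (m.1 + 1) * (2 ^ (m.2.1 + 1) * 2 ^ (m.2.2 + 1))) ^ 2)⁻¹ *
      min (devRow μ e (2 ^ (m.1 + 1)) (2 ^ (m.2.1 + 1)) (2 ^ (m.2.2 + 1)) ω)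
        (2 ^ (m.2.2 + 1) * ∑ t ∈ Finset.range (2 ^ (m.2.2 + 1)),
          devCol μ e (2 ^ (m.1 + 1)) (2 ^ (m.2.1 + 1)) t ω)
  have hmeas : ∀ m : ℕ × ℕ × ℕ, Measurable fun ω =>
      min (devRow μ e (2 ^ (m.1 + 1)) (2 ^ (m.2.1 + 1)) (2 ^ (m.2.2 + 1)) ω)
        ((2 : ℝ) ^ (m.2.2 + 1) * ∑ t ∈ Finset.range (2 ^ (m.2.2 + 1)),
          devCol μ e (2 ^ (m.1 + 1)) (2 ^ (m.2.1 + 1)) t ω) := fun m =>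
    (measurable_devRow he _ _ _).min
      ((Finset.measurable_fun_sum _ fun t _ => measurable_devCol he _ _ _).const_mul _)
  have hf0 : ∀ m ω, 0 ≤ f m ω := fun m ω => mul_nonneg (by positivity)
    (le_min (devRow_nonneg _ _ _ _ _) (mul_nonneg (by positivity)
      (Finset.sum_nonneg fun t _ => devCol_nonneg _ _ _ _ _)))
  set r : ℝ := (√2)⁻¹ with hr
  have hr0 : 0 < r := by positivity
  have hsum : Summable fun n : ℕ => r ^ (n + 1) := by
    refine (summable_nat_add_iff 1).2 (summable_geometric_of_lt_one hr0.le ?_)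
    exact inv_lt_one_of_one_lt₀ (Real.lt_sqrt_of_sq_lt (by norm_num))
  have hae := ae_tendsto_cofinite_of_summable (μ := μ) f (fun m => (hmeas m).const_mul _) hf0
    (fun m => K * (r ^ (m.1 + 1) * (r ^ (m.2.1 + 1) * r ^ (m.2.2 + 1))))
    (fun m => by positivity)
    ((summable_triple hsum hsum hsum (fun n => by positivity) (fun n => by positivity)
      (fun n => by positivity)).mul_left K) (fun m => by
      set P1 := m.1 + 1
      set P2 := m.2.1 + 1
      set P3 := m.2.2 + 1
      have b1 : ∫⁻ ω, ENNReal.ofReal (min (devRow μ e (2 ^ P1) (2 ^ P2) (2 ^ P3) ω)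
          (2 ^ P3 * ∑ t ∈ Finset.range (2 ^ P3), devCol μ e (2 ^ P1) (2 ^ P2) t ω)) ∂μ ≤
          ENNReal.ofReal (K * ((2 ^ P1) ^ 2 * (2 ^ P2 * 2 ^ P3))) := by
        refine (lintegral_mono fun ω => ENNReal.ofReal_le_ofReal (min_le_left _ _)).trans ?_
        refine (hC _ _ _).trans (ENNReal.ofReal_le_ofReal ?_)
        push_cast
        exact mul_le_mul_of_nonneg_right (le_max_left _ _) (by positivity)
      have b2 : ∫⁻ ω, ENNReal.ofReal (min (devRow μ e (2 ^ P1) (2 ^ P2) (2 ^ P3) ω)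
          (2 ^ P3 * ∑ t ∈ Finset.range (2 ^ P3), devCol μ e (2 ^ P1) (2 ^ P2) t ω)) ∂μ ≤
          ENNReal.ofReal (K * (2 ^ P1 * (2 ^ P2 * 2 ^ P3) ^ 2)) := by
        refine (lintegral_mono fun ω => ENNReal.ofReal_le_ofReal (min_le_right _ _)).trans ?_
        simp_rw [ENNReal.ofReal_mul (p := (2 : ℝ) ^ P3) (by positivity),
          ENNReal.ofReal_sum_of_nonneg fun t (_ : t ∈ Finset.range (2 ^ P3)) =>
            devCol_nonneg (μ := μ) e (2 ^ P1) (2 ^ P2) t _]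
        rw [lintegral_const_mul _ (Finset.measurable_fun_sum _
          fun t _ => (measurable_devCol he _ _ _).ennreal_ofReal),
          lintegral_finsetSum _ fun t _ => (measurable_devCol he _ _ _).ennreal_ofReal]
        refine (mul_le_mul_right (Finset.sum_le_sum fun t _ => hD _ _ _) _).trans ?_
        rw [← ENNReal.ofReal_sum_of_nonneg fun _ _ => by positivity,
          ← ENNReal.ofReal_mul (by positivity)]
        refine ENNReal.ofReal_le_ofReal ?_
        simp only [Finset.sum_const, Finset.card_range, nsmul_eq_mul]
        push_cast
        calc _ = D * (2 ^ P1 * (2 ^ P2 * 2 ^ P3) ^ 2) := by ring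
          _ ≤ _ := mul_le_mul_of_nonneg_right (le_max_right _ _) (by positivity)
      have b3 := le_min b1 b2
      rw [← ENNReal.ofReal_min, ← mul_min_of_nonneg _ _ hK0] at b3
      -- A minimum is at most the geometric mean. Below, u² and w² are the reciprocals of 2^P1 and
      -- 2^P2 · 2^P3, so the claim becomes a comparison of u with w.
      have b4 : min (((2 : ℝ) ^ P1) ^ 2 * (2 ^ P2 * 2 ^ P3)) (2 ^ P1 * (2 ^ P2 * 2 ^ P3) ^ 2) ≤
          ((2 : ℝ) ^ P1 * (2 ^ P2 * 2 ^ P3)) ^ 2 * (r ^ P1 * (r ^ P2 * r ^ P3)) := by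
        have hpos : (0 : ℝ) < 2 ^ P1 * (2 ^ P2 * 2 ^ P3) := by positivity
        set u : ℝ := r ^ P1 with hu
        set w : ℝ := r ^ P2 * r ^ P3 with hw
        have hu0 : 0 < u := by positivity
        have hw0 : 0 < w := by positivity
        have e1 : (2 : ℝ) ^ P1 = (u ^ 2)⁻¹ := by rw [hu, sq_inv_sqrt_two_pow, inv_inv]
        have e2 : (2 : ℝ) ^ P2 * 2 ^ P3 = (w ^ 2)⁻¹ := by
          rw [hw, mul_pow, sq_inv_sqrt_two_pow, sq_inv_sqrt_two_pow, mul_inv, inv_inv, inv_inv]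
        rw [e1, e2]
        rcases le_total u w with huw | huw
        · refine (min_le_right _ _).trans ?_
          rw [← sub_nonneg, show ((u ^ 2)⁻¹ * (w ^ 2)⁻¹) ^ 2 * (u * w) -
            (u ^ 2)⁻¹ * (w ^ 2)⁻¹ ^ 2 = (w - u) * (u⁻¹ ^ 3 * w⁻¹ ^ 4) by field_simp]
          exact mul_nonneg (sub_nonneg.2 huw) (by positivity)
        · refine (min_le_left _ _).trans ?_
          rw [← sub_nonneg, show ((u ^ 2)⁻¹ * (w ^ 2)⁻¹) ^ 2 * (u * w) -
            (u ^ 2)⁻¹ ^ 2 * (w ^ 2)⁻¹ = (u - w) * (u⁻¹ ^ 4 * w⁻¹ ^ 3) by field_simp]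
          exact mul_nonneg (sub_nonneg.2 huw) (by positivity)
      simp only [f]
      simp_rw [ENNReal.ofReal_mul (p := (((2 : ℝ) ^ (m.1 + 1) *
        (2 ^ (m.2.1 + 1) * 2 ^ (m.2.2 + 1))) ^ 2)⁻¹) (by positivity)]
      rw [lintegral_const_mul _ (hmeas m).ennreal_ofReal]
      refine (mul_le_mul_right b3 _).trans ?_
      rw [← ENNReal.ofReal_mul (by positivity)]
      refine ENNReal.ofReal_le_ofReal ?_
      rw [inv_mul_le_iff₀ (by positivity)]
      calc _ ≤ K * (((2 : ℝ) ^ P1 * (2 ^ P2 * 2 ^ P3)) ^ 2 * (r ^ P1 * (r ^ P2 * r ^ P3))) :=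
            mul_le_mul_of_nonneg_left b4 hK0
        _ = _ := by ring)
  filter_upwards [hae] with ω hω η hη
  -- Relative to p1 p2 T, the means contribute c / p1 in the row bound and c / p2 in the column
  -- bound; the factor 8 is three doublings.
  have hlim : Tendsto (fun q : ℕ × ℕ × ℕ => 8 * (c / q.1 + c / q.2.1 + √(f (block q) ω)))
      minAtTop (𝓝 (8 * (0 + 0 + √0))) := by
    refine Tendsto.const_mul _ (Tendsto.add (Tendsto.add ?_ ?_) ?_)
    · exact tendsto_const_nhds.div_atTop (tendsto_natCast_atTop_atTop.comp tendsto_fst_minAtTop)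
    · exact tendsto_const_nhds.div_atTop (tendsto_natCast_atTop_atTop.comp tendsto_snd_minAtTop)
    · exact (Real.continuous_sqrt.tendsto 0).comp (hω.comp tendsto_block)
  have hlim' := hlim.eventually_lt_const (show 8 * (0 + 0 + √0) < η by simpa using hη)
  filter_upwards [hlim', tendsto_fst_minAtTop.eventually_ge_atTop 2,
    tendsto_snd_minAtTop.eventually_ge_atTop 2, tendsto_thd_minAtTop.eventually_ge_atTop 2]
    with q hq h1 h2 h3 v
  obtain ⟨p1, p2, T⟩ := q
  simp only at hq h1 h2 h3 ⊢
  have hp1 : (0 : ℝ) < p1 := by positivity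
  have hp2 : (0 : ℝ) < p2 := by positivity
  have hT : (0 : ℝ) < T := by positivity
  have hP1 := two_pow_log_succ_le (n := p1) (by omega)
  have hP2 := two_pow_log_succ_le (n := p2) (by omega)
  have hP3 := two_pow_log_succ_le (n := T) (by omega)
  have hQ1 : (p1 : ℝ) ≤ 2 ^ (Nat.log 2 p1 + 1) := by exact_mod_cast le_two_pow_log_succ p1
  have hQ2 : (p2 : ℝ) ≤ 2 ^ (Nat.log 2 p2 + 1) := by exact_mod_cast le_two_pow_log_succ p2
  refine noiseForm_le_of_le (le_two_pow_log_succ p1) (le_two_pow_log_succ p2)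
    (le_two_pow_log_succ T) (fun w => ?_) v
  obtain ⟨hrow, hcol⟩ := hc (2 ^ (Nat.log 2 p1 + 1)) (2 ^ (Nat.log 2 p2 + 1))
    (2 ^ (Nat.log 2 T + 1)) ω w
  have hV : 0 ≤ ∑ i ∈ Finset.range (2 ^ (Nat.log 2 p1 + 1)), w i ^ 2 :=
    Finset.sum_nonneg fun i _ => sq_nonneg _
  set P1 : ℝ := 2 ^ (Nat.log 2 p1 + 1) with hP1d
  set P2 : ℝ := 2 ^ (Nat.log 2 p2 + 1) with hP2d
  set P3 : ℝ := 2 ^ (Nat.log 2 T + 1) with hP3d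
  set φ := f (block (p1, p2, T)) ω with hφ
  have hP1p : 0 < P1 := by positivity
  have hP2p : 0 < P2 := by positivity
  have hP3p : 0 < P3 := by positivity
  have hmin : √(min (devRow μ e (2 ^ (Nat.log 2 p1 + 1)) (2 ^ (Nat.log 2 p2 + 1))
      (2 ^ (Nat.log 2 T + 1)) ω) (P3 *
        ∑ t ∈ Finset.range (2 ^ (Nat.log 2 T + 1)), devCol μ e (2 ^ (Nat.log 2 p1 + 1))
          (2 ^ (Nat.log 2 p2 + 1)) t ω)) = √φ * (P1 * (P2 * P3)) := by
    simp only [hφ, f, block]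
    rw [Real.sqrt_mul (by positivity), Real.sqrt_inv, Real.sqrt_sq (by positivity)]
    change _ = (P1 * (P2 * P3))⁻¹ * _ * (P1 * (P2 * P3))
    rw [mul_right_comm, inv_mul_cancel₀ (by positivity), one_mul]
  have hc1 : c ≤ c / p1 * P1 := by
    rw [div_mul_eq_mul_div, le_div_iff₀ hp1]
    exact mul_le_mul_of_nonneg_left hQ1 hc0
  have hc2 : c ≤ c / p2 * P2 := by
    rw [div_mul_eq_mul_div, le_div_iff₀ hp2]
    exact mul_le_mul_of_nonneg_left hQ2 hc0
  have hfin : (c / p1 + c / p2 + √φ) * (P1 * (P2 * P3)) ≤ η * p1 * (p2 * T) := by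
    calc _ ≤ (c / p1 + c / p2 + √φ) * (2 * p1 * (2 * p2 * (2 * T))) := by gcongr
      _ = 8 * (c / p1 + c / p2 + √φ) * (p1 * (p2 * T)) := by ring
      _ ≤ η * (p1 * (p2 * T)) := by gcongr
      _ = _ := by ring
  push_cast at hrow hcol
  have hx1 : c * (P2 * P3) ≤ c / p1 * P1 * (P2 * P3) := by gcongr
  have hx2 : c * (P1 * P3) ≤ c / p2 * P2 * (P1 * P3) := by gcongr
  have hy1 : 0 ≤ c / p1 * (P1 * (P2 * P3)) := by positivity
  have hy2 : 0 ≤ c / p2 * (P1 * (P2 * P3)) := by positivity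
  -- The smaller deviation decides which of the two bounds is used.
  rcases min_choice (devRow μ e (2 ^ (Nat.log 2 p1 + 1)) (2 ^ (Nat.log 2 p2 + 1))
      (2 ^ (Nat.log 2 T + 1)) ω) (P3 *
        ∑ t ∈ Finset.range (2 ^ (Nat.log 2 T + 1)), devCol μ e (2 ^ (Nat.log 2 p1 + 1))
          (2 ^ (Nat.log 2 p2 + 1)) t ω) with hch | hch
  · rw [hch] at hmin
    refine hrow.trans (mul_le_mul_of_nonneg_right (le_trans ?_ hfin) hV)
    rw [hmin]
    linarith
  · rw [hch] at hmin
    refine hcol.trans (mul_le_mul_of_nonneg_right (le_trans ?_ hfin) hV)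
    rw [hmin]
    linarith

end MatrixFactor

namespace MatrixFactor

/-! ### The sample second moment matrix as signal plus noise -/

theorem dotProduct_self_nonneg' {n : ℕ} (x : Fin n → ℝ) : 0 ≤ x ⬝ᵥ x :=
  Finset.sum_nonneg fun i _ => mul_self_nonneg (x i)

/-- Young's inequality absorbs the cross term of signal x and noise y; θ will be small, and the
noise smaller still. -/
theorem add_dotProduct_add_le {n : ℕ} (x y : Fin n → ℝ) {θ : ℝ} (hθ : 0 < θ) :
    (x + y) ⬝ᵥ (x + y) ≤ (1 + θ) * (x ⬝ᵥ x) + (1 + 1 / θ) * (y ⬝ᵥ y) := by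
  have h := dotProduct_self_nonneg' (θ • x - y)
  simp only [dotProduct_sub, sub_dotProduct, smul_dotProduct, dotProduct_smul, smul_eq_mul,
    dotProduct_comm y x] at h
  have h2 : 2 * (x ⬝ᵥ y) ≤ θ * (x ⬝ᵥ x) + 1 / θ * (y ⬝ᵥ y) := by
    refine le_of_mul_le_mul_left ?_ hθ
    have : θ * (1 / θ * (y ⬝ᵥ y)) = y ⬝ᵥ y := by field_simp
    linarith
  rw [dotProduct_add, add_dotProduct, add_dotProduct, dotProduct_comm y x]
  linarith

theorem le_add_dotProduct_add {n : ℕ} (x y : Fin n → ℝ) {θ : ℝ} (hθ : 0 < θ) :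
    (1 - θ) * (x ⬝ᵥ x) - 1 / θ * (y ⬝ᵥ y) ≤ (x + y) ⬝ᵥ (x + y) := by
  have h := dotProduct_self_nonneg' (θ • x + y)
  simp only [dotProduct_add, add_dotProduct, smul_dotProduct, dotProduct_smul, smul_eq_mul,
    dotProduct_comm y x] at h
  have h2 : -(2 * (x ⬝ᵥ y)) ≤ θ * (x ⬝ᵥ x) + 1 / θ * (y ⬝ᵥ y) := by
    refine le_of_mul_le_mul_left ?_ hθ
    have : θ * (1 / θ * (y ⬝ᵥ y)) = y ⬝ᵥ y := by field_simp
    linarith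
  rw [dotProduct_add, add_dotProduct, add_dotProduct, dotProduct_comm y x]
  linarith [dotProduct_self_nonneg' y]

theorem abs_mulVec_dotProduct_sub_le {n k : ℕ} (hn : 0 < n) (A : Matrix (Fin n) (Fin k) ℝ)
    (y : Fin k → ℝ) : |(A *ᵥ y) ⬝ᵥ (A *ᵥ y) - n * (y ⬝ᵥ y)| ≤
      n * (‖(n : ℝ)⁻¹ • (Aᵀ * A) - 1‖ * (y ⬝ᵥ y)) := by
  have hn' : (0 : ℝ) < n := by exact_mod_cast hn
  have e : (A *ᵥ y) ⬝ᵥ (A *ᵥ y) - n * (y ⬝ᵥ y) =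
      n * (y ⬝ᵥ ((n : ℝ)⁻¹ • (Aᵀ * A) - 1) *ᵥ y) := by
    rw [Matrix.sub_mulVec, Matrix.smul_mulVec, Matrix.one_mulVec, dotProduct_sub,
      dotProduct_smul, smul_eq_mul, mul_sub, mul_inv_cancel_left₀ hn'.ne', ← Matrix.mulVec_mulVec,
      Matrix.dotProduct_mulVec, Matrix.dotProduct_mulVec, Matrix.vecMul_transpose,
      ← Matrix.dotProduct_mulVec]
  rw [e, abs_mul, abs_of_pos hn']
  exact mul_le_mul_of_nonneg_left (abs_form_le _ _) hn'.le

/-- A A' inherits the norm bound of A'A by duality. -/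
theorem vecMul_dotProduct_vecMul_le {n k : ℕ} (hn : 0 < n) (A : Matrix (Fin n) (Fin k) ℝ)
    (v : Fin n → ℝ) : (v ᵥ* A) ⬝ᵥ (v ᵥ* A) ≤
      n * (1 + ‖(n : ℝ)⁻¹ • (Aᵀ * A) - 1‖) * (v ⬝ᵥ v) := by
  have h := sum_sq_le_of_dual Finset.univ Finset.univ (fun k i => A i k)
    (B := n * (1 + ‖(n : ℝ)⁻¹ • (Aᵀ * A) - 1‖)) (by positivity) (fun y => ?_) v
  · simpa [dotProduct, Matrix.vecMul, sq] using h
  · have h1 := (abs_le.1 (abs_mulVec_dotProduct_sub_le hn A y)).2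
    have e : ∑ i, (∑ k, y k * A i k) ^ 2 = (A *ᵥ y) ⬝ᵥ (A *ᵥ y) := by
      simp only [dotProduct, Matrix.mulVec, sq, mul_comm]
    have e' : ∑ k, y k ^ 2 = y ⬝ᵥ y := by simp only [dotProduct, sq]
    rw [e, e']
    linarith

theorem form_secondMoment {p1 p2 : ℕ} (T : ℕ) (X : ℕ → Matrix (Fin p1) (Fin p2) ℝ)
    (v : Fin p1 → ℝ) : v ⬝ᵥ secondMoment T X *ᵥ v =
      ((T : ℝ) * p2)⁻¹ * ∑ t ∈ Finset.range T, (v ᵥ* X t) ⬝ᵥ (v ᵥ* X t) := by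
  rw [secondMoment, Matrix.smul_mulVec, dotProduct_smul, smul_eq_mul, Matrix.sum_mulVec,
    dotProduct_sum]
  congr 1
  refine Finset.sum_congr rfl fun t _ => ?_
  rw [← Matrix.mulVec_mulVec, Matrix.mulVec_transpose, Matrix.dotProduct_mulVec]

variable {Ω : Type*} {k1 k2 : ℕ} {R : ∀ p1 : ℕ, Matrix (Fin p1) (Fin k1) ℝ}
  {C : ∀ p2 : ℕ, Matrix (Fin p2) (Fin k2) ℝ} {F : ℕ → Ω → Matrix (Fin k1) (Fin k2) ℝ}
  {e : ℕ → ℕ → ℕ → Ω → ℝ} {p1 p2 T : ℕ} {ω : Ω}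

theorem vecMul_obs (t : ℕ) (v : Fin p1 → ℝ) : v ᵥ* obs R C F e p1 p2 t ω =
    C p2 *ᵥ ((v ᵥ* R p1) ᵥ* F t ω) + v ᵥ* errMat e p1 p2 t ω := by
  rw [obs, Matrix.vecMul_add, ← Matrix.vecMul_vecMul, ← Matrix.vecMul_vecMul,
    Matrix.vecMul_transpose]

theorem sum_vecMul_errMat_le {B : ℝ}
    (h : ∀ v, noiseForm e p1 p2 T ω v ≤ B * ∑ i ∈ Finset.range p1, v i ^ 2) (v : Fin p1 → ℝ) :
    ∑ t ∈ Finset.range T, (v ᵥ* errMat e p1 p2 t ω) ⬝ᵥ (v ᵥ* errMat e p1 p2 t ω) ≤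
      B * (v ⬝ᵥ v) := by
  have hv := h fun i => if hi : i < p1 then v ⟨i, hi⟩ else 0
  rw [noiseForm, Finset.sum_product] at hv
  simpa [Finset.sum_range, dotProduct, Matrix.vecMul, errMat, ← sq] using hv

theorem sum_vecMul_factor (w : Fin k1 → ℝ) (hT : 0 < T) :
    ∑ t ∈ Finset.range T, (w ᵥ* F t ω) ⬝ᵥ (w ᵥ* F t ω) =
      T * (w ⬝ᵥ ((T : ℝ)⁻¹ • ∑ t ∈ Finset.range T, F t ω * (F t ω)ᵀ) *ᵥ w) := by
  have hT' : (T : ℝ) ≠ 0 := by positivity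
  rw [Matrix.smul_mulVec, dotProduct_smul, smul_eq_mul, mul_inv_cancel_left₀ hT',
    Matrix.sum_mulVec, dotProduct_sum]
  refine Finset.sum_congr rfl fun t _ => ?_
  rw [← Matrix.mulVec_mulVec, Matrix.mulVec_transpose, Matrix.dotProduct_mulVec]

/-- Replace C'C / p2 by the identity and the sample second moment of F by S, keeping both errors
explicit. The lower bound needs the factor 1 - γ to be nonnegative. -/
theorem signal_bounds (hp2 : 0 < p2) (hT : 0 < T) (S : Matrix (Fin k1) (Fin k1) ℝ)
    (w : Fin k1 → ℝ) :
    ((T : ℝ) * p2)⁻¹ * ∑ t ∈ Finset.range T,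
        (C p2 *ᵥ (w ᵥ* F t ω)) ⬝ᵥ (C p2 *ᵥ (w ᵥ* F t ω)) ≤
      (1 + ‖(p2 : ℝ)⁻¹ • ((C p2)ᵀ * C p2) - 1‖) * (w ⬝ᵥ S *ᵥ w +
        ‖(T : ℝ)⁻¹ • ∑ t ∈ Finset.range T, F t ω * (F t ω)ᵀ - S‖ * (w ⬝ᵥ w)) ∧
    (‖(p2 : ℝ)⁻¹ • ((C p2)ᵀ * C p2) - 1‖ ≤ 1 →
      (1 - ‖(p2 : ℝ)⁻¹ • ((C p2)ᵀ * C p2) - 1‖) * (w ⬝ᵥ S *ᵥ w -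
        ‖(T : ℝ)⁻¹ • ∑ t ∈ Finset.range T, F t ω * (F t ω)ᵀ - S‖ * (w ⬝ᵥ w)) ≤
      ((T : ℝ) * p2)⁻¹ * ∑ t ∈ Finset.range T,
        (C p2 *ᵥ (w ᵥ* F t ω)) ⬝ᵥ (C p2 *ᵥ (w ᵥ* F t ω))) := by
  set γ := ‖(p2 : ℝ)⁻¹ • ((C p2)ᵀ * C p2) - 1‖ with hγ
  set G := (T : ℝ)⁻¹ • ∑ t ∈ Finset.range T, F t ω * (F t ω)ᵀ with hG
  have hp2' : (0 : ℝ) < p2 := by exact_mod_cast hp2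
  have hT' : (0 : ℝ) < T := by exact_mod_cast hT
  have hsum := sum_vecMul_factor (F := F) (ω := ω) w hT
  have hd := abs_le.1 (abs_form_le (G - S) w)
  rw [Matrix.sub_mulVec, dotProduct_sub] at hd
  have hγ0 : 0 ≤ γ := norm_nonneg _
  constructor
  · rw [inv_mul_le_iff₀ (by positivity)]
    calc _ ≤ ∑ t ∈ Finset.range T, p2 * (1 + γ) * ((w ᵥ* F t ω) ⬝ᵥ (w ᵥ* F t ω)) := by
          refine Finset.sum_le_sum fun t _ => ?_
          have := (abs_le.1 (abs_mulVec_dotProduct_sub_le hp2 (C p2) (w ᵥ* F t ω))).2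
          linarith
      _ = T * p2 * ((1 + γ) * (w ⬝ᵥ G *ᵥ w)) := by rw [← Finset.mul_sum, hsum]; ring
      _ ≤ _ := by
          refine mul_le_mul_of_nonneg_left (mul_le_mul_of_nonneg_left ?_ ?_) ?_
          · linarith [hd.2]
          · positivity
          · positivity
  · intro hγ1
    rw [le_inv_mul_iff₀ (by positivity)]
    calc _ ≤ T * p2 * ((1 - γ) * (w ⬝ᵥ G *ᵥ w)) := by
          refine mul_le_mul_of_nonneg_left (mul_le_mul_of_nonneg_left ?_ ?_) ?_
          · linarith [hd.1]
          · linarith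
          · positivity
      _ = ∑ t ∈ Finset.range T, p2 * (1 - γ) * ((w ᵥ* F t ω) ⬝ᵥ (w ᵥ* F t ω)) := by
          rw [← Finset.mul_sum, hsum]; ring
      _ ≤ _ := by
          refine Finset.sum_le_sum fun t _ => ?_
          have := (abs_le.1 (abs_mulVec_dotProduct_sub_le hp2 (C p2) (w ᵥ* F t ω))).1
          linarith

/-- Eigenvalues beyond the number of factors are bounded by the noise. -/
theorem lamHat_le_of_noise {x : ℝ} (hp2 : 0 < p2) (hT : 0 < T)
    (h : ∀ v, noiseForm e p1 p2 T ω v ≤ x * (p2 * T) * ∑ i ∈ Finset.range p1, v i ^ 2) {j : ℕ}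
    (hj : k1 < j) (hjp : j ≤ p1) : lamHat R C F e j p1 p2 T ω ≤ x := by
  have hp2' : (0 : ℝ) < p2 := by exact_mod_cast hp2
  have hT' : (0 : ℝ) < T := by exact_mod_cast hT
  refine eig_le_of_form_le _ hjp hj (Matrix.vecMulLinear (R p1)) fun v hv => ?_
  have hv' : v ᵥ* R p1 = 0 := hv
  rw [form_secondMoment, inv_mul_le_iff₀ (by positivity)]
  simp only [vecMul_obs, hv', Matrix.zero_vecMul, Matrix.mulVec_zero, zero_add]
  refine (sum_vecMul_errMat_le h v).trans (le_of_eq (by ring))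

theorem lamHat_nonneg (j : ℕ) : 0 ≤ lamHat R C F e j p1 p2 T ω :=
  eig_nonneg _ (fun v => by
    rw [form_secondMoment]
    exact mul_nonneg (by positivity) (Finset.sum_nonneg fun t _ => dotProduct_self_nonneg' _)) j

/-! ### Two-sided bounds and the limit of the eigenvalues of order p1 -/

theorem lamHat_le {S : Matrix (Fin k1) (Fin k1) ℝ} (hS : S.IsHermitian) {η θ : ℝ}
    (hθ : 0 < θ) (hp1 : 0 < p1) (hp2 : 0 < p2) (hT : 0 < T)
    (h : ∀ v, noiseForm e p1 p2 T ω v ≤ η * p1 * (p2 * T) * ∑ i ∈ Finset.range p1, v i ^ 2)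
    {j : ℕ} (h1 : 1 ≤ j) (hj : j ≤ k1) (hjp : j ≤ p1) (hpos : 0 ≤ eig hS j) :
    lamHat R C F e j p1 p2 T ω ≤ ((1 + θ) * ((1 + ‖(p2 : ℝ)⁻¹ • ((C p2)ᵀ * C p2) - 1‖) *
      ((eig hS j + ‖(T : ℝ)⁻¹ • ∑ t ∈ Finset.range T, F t ω * (F t ω)ᵀ - S‖) *
        (1 + ‖(p1 : ℝ)⁻¹ • ((R p1)ᵀ * R p1) - 1‖))) + (1 + 1 / θ) * η) * p1 := by
  -- Test on those v for which R' v is orthogonal to the first j - 1 eigenvectors of S: only j - 1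
  -- conditions on v.
  obtain ⟨L, hL⟩ := exists_form_le_eig hS h1 hj
  refine eig_le_of_form_le _ hjp (Nat.sub_lt h1 one_pos)
    (L ∘ₗ Matrix.vecMulLinear (R p1)) fun v hv => ?_
  set w := v ᵥ* R p1 with hw
  have hform := hL w hv
  have hsig := (signal_bounds (C := C) (F := F) (ω := ω) hp2 hT S w).1
  have hR := vecMul_dotProduct_vecMul_le hp1 (R p1) v
  rw [← hw] at hR
  set α := ‖(p1 : ℝ)⁻¹ • ((R p1)ᵀ * R p1) - 1‖
  set β := ‖(T : ℝ)⁻¹ • ∑ t ∈ Finset.range T, F t ω * (F t ω)ᵀ - S‖ with hβ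
  set γ := ‖(p2 : ℝ)⁻¹ • ((C p2)ᵀ * C p2) - 1‖
  have hβ0 : 0 ≤ β := norm_nonneg _
  have hγ0 : 0 ≤ γ := norm_nonneg _
  have hp2' : (0 : ℝ) < p2 := by exact_mod_cast hp2
  have hT' : (0 : ℝ) < T := by exact_mod_cast hT
  have hnoise : ((T : ℝ) * p2)⁻¹ * ∑ t ∈ Finset.range T,
      (v ᵥ* errMat e p1 p2 t ω) ⬝ᵥ (v ᵥ* errMat e p1 p2 t ω) ≤ η * p1 * (v ⬝ᵥ v) := by
    rw [inv_mul_le_iff₀ (by positivity)]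
    exact (sum_vecMul_errMat_le h v).trans (le_of_eq (by ring))
  rw [form_secondMoment]
  calc _ ≤ ((T : ℝ) * p2)⁻¹ * ∑ t ∈ Finset.range T,
        ((1 + θ) * ((C p2 *ᵥ (w ᵥ* F t ω)) ⬝ᵥ (C p2 *ᵥ (w ᵥ* F t ω))) + (1 + 1 / θ) *
          ((v ᵥ* errMat e p1 p2 t ω) ⬝ᵥ (v ᵥ* errMat e p1 p2 t ω))) := by
        refine mul_le_mul_of_nonneg_left (Finset.sum_le_sum fun t _ => ?_) (by positivity)
        rw [vecMul_obs]
        exact add_dotProduct_add_le _ _ hθ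
    _ = (1 + θ) * (((T : ℝ) * p2)⁻¹ * ∑ t ∈ Finset.range T,
        (C p2 *ᵥ (w ᵥ* F t ω)) ⬝ᵥ (C p2 *ᵥ (w ᵥ* F t ω))) + (1 + 1 / θ) *
          (((T : ℝ) * p2)⁻¹ * ∑ t ∈ Finset.range T,
            (v ᵥ* errMat e p1 p2 t ω) ⬝ᵥ (v ᵥ* errMat e p1 p2 t ω)) := by
        rw [Finset.sum_add_distrib, ← Finset.mul_sum, ← Finset.mul_sum]; ring
    _ ≤ (1 + θ) * ((1 + γ) * ((eig hS j + β) * (p1 * (1 + α) * (v ⬝ᵥ v)))) +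
          (1 + 1 / θ) * (η * p1 * (v ⬝ᵥ v)) := by
        refine add_le_add (mul_le_mul_of_nonneg_left (hsig.trans ?_) (by positivity))
          (mul_le_mul_of_nonneg_left hnoise (by positivity))
        refine mul_le_mul_of_nonneg_left ?_ (by positivity)
        calc _ ≤ (eig hS j + β) * (w ⬝ᵥ w) := by linarith
          _ ≤ _ := mul_le_mul_of_nonneg_left hR (by positivity)
    _ = _ := by ring

/-- The test vectors are v = R (R'R)⁻¹ u with u in the span of the first j eigenvectors of S, so
that R' v = u exactly. The bound `hα` makes R'R invertible. -/
theorem le_lamHat {S : Matrix (Fin k1) (Fin k1) ℝ} (hS : S.IsHermitian) {η θ : ℝ}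
    (hθ : 0 < θ) (hθ1 : θ ≤ 1) (hp1 : 0 < p1) (hp2 : 0 < p2) (hT : 0 < T)
    (h : ∀ v, noiseForm e p1 p2 T ω v ≤ η * p1 * (p2 * T) * ∑ i ∈ Finset.range p1, v i ^ 2)
    {j : ℕ} (h1 : 1 ≤ j) (hj : j ≤ k1) (hjp : j ≤ p1)
    (hα : ‖(p1 : ℝ)⁻¹ • ((R p1)ᵀ * R p1) - 1‖ < 1)
    (hγ : ‖(p2 : ℝ)⁻¹ • ((C p2)ᵀ * C p2) - 1‖ ≤ 1)
    (hβ : ‖(T : ℝ)⁻¹ • ∑ t ∈ Finset.range T, F t ω * (F t ω)ᵀ - S‖ ≤ eig hS j) :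
    ((1 - θ) * ((1 - ‖(p2 : ℝ)⁻¹ • ((C p2)ᵀ * C p2) - 1‖) *
      ((eig hS j - ‖(T : ℝ)⁻¹ • ∑ t ∈ Finset.range T, F t ω * (F t ω)ᵀ - S‖) *
        (1 - ‖(p1 : ℝ)⁻¹ • ((R p1)ᵀ * R p1) - 1‖))) - 1 / θ * η) * p1 ≤
      lamHat R C F e j p1 p2 T ω := by
  set α := ‖(p1 : ℝ)⁻¹ • ((R p1)ᵀ * R p1) - 1‖ with hαd
  have hp1' : (0 : ℝ) < p1 := by exact_mod_cast hp1
  have hp2' : (0 : ℝ) < p2 := by exact_mod_cast hp2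
  have hT' : (0 : ℝ) < T := by exact_mod_cast hT
  have hRlow : ∀ u, p1 * (1 - α) * (u ⬝ᵥ u) ≤ (R p1 *ᵥ u) ⬝ᵥ (R p1 *ᵥ u) := by
    intro u
    have := (abs_le.1 (abs_mulVec_dotProduct_sub_le hp1 (R p1) u)).1
    linarith
  have hα' : 0 < p1 * (1 - α) := mul_pos hp1' (by linarith)
  have hdet : IsUnit ((R p1)ᵀ * R p1).det := by
    rw [isUnit_iff_ne_zero]
    intro h0
    obtain ⟨u, hu0, hu⟩ := Matrix.exists_mulVec_eq_zero_iff.2 h0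
    have h2 : (R p1 *ᵥ u) ⬝ᵥ (R p1 *ᵥ u) = 0 := by
      rw [Matrix.dotProduct_mulVec, ← Matrix.mulVec_transpose, Matrix.mulVec_mulVec, hu,
        zero_dotProduct]
    have h3 := hRlow u
    rw [h2] at h3
    have h4 : u ⬝ᵥ u ≤ 0 := by
      by_contra hc
      exact absurd h3 (not_le.2 (mul_pos hα' (not_le.1 hc)))
    exact hu0 (dotProduct_self_eq_zero.1 (le_antisymm h4 (dotProduct_self_nonneg' u)))
  obtain ⟨K, hK⟩ := exists_eig_le_form hS h1 hj
  set D := ((R p1)ᵀ * R p1)⁻¹ with hD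
  have hRD : ∀ u, (R p1 *ᵥ (D *ᵥ u)) ᵥ* R p1 = u := by
    intro u
    rw [← Matrix.mulVec_transpose, Matrix.mulVec_mulVec, Matrix.mulVec_mulVec,
      Matrix.mul_nonsing_inv _ hdet, Matrix.one_mulVec]
  refine le_eig_of_le_form _ h1 hjp (Nat.sub_add_cancel hj).le K
    ((R p1).mulVecLin ∘ₗ D.mulVecLin) (fun u hu => ?_) fun u hu => ?_
  · have hu' : R p1 *ᵥ (D *ᵥ u) = 0 := hu
    rw [← hRD u, hu', Matrix.zero_vecMul]
  have hform := hK u hu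
  simp only [LinearMap.comp_apply, Matrix.mulVecLin_apply]
  set v := R p1 *ᵥ (D *ᵥ u) with hv
  have hw : v ᵥ* R p1 = u := hRD u
  have hsig := (signal_bounds (C := C) (F := F) (ω := ω) hp2 hT S u).2 hγ
  set β := ‖(T : ℝ)⁻¹ • ∑ t ∈ Finset.range T, F t ω * (F t ω)ᵀ - S‖ with hβd
  set γ := ‖(p2 : ℝ)⁻¹ • ((C p2)ᵀ * C p2) - 1‖
  -- Here |v|² = u · Du ≤ |u| |Du|, while |v|² = |R D u|² ≥ p1 (1 - α) |Du|²; eliminate |Du|.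
  have hvw : p1 * (1 - α) * (v ⬝ᵥ v) ≤ u ⬝ᵥ u := by
    have ha := hRlow (D *ᵥ u)
    rw [← hv] at ha
    have hb : v ⬝ᵥ v = u ⬝ᵥ (D *ᵥ u) := by
      conv_lhs => rw [hv, ← hv, Matrix.dotProduct_mulVec, hw]
    have hc := Finset.sum_mul_sq_le_sq_mul_sq Finset.univ u (D *ᵥ u)
    have hc' : (v ⬝ᵥ v) ^ 2 ≤ (u ⬝ᵥ u) * ((D *ᵥ u) ⬝ᵥ (D *ᵥ u)) := by
      rw [hb]
      simpa [dotProduct, sq] using hc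
    rcases (dotProduct_self_nonneg' v).eq_or_lt with h0 | h0
    · rw [← h0, mul_zero]; exact dotProduct_self_nonneg' u
    · refine le_of_mul_le_mul_right ?_ h0
      calc _ = p1 * (1 - α) * (v ⬝ᵥ v) ^ 2 := by ring
        _ ≤ p1 * (1 - α) * ((u ⬝ᵥ u) * ((D *ᵥ u) ⬝ᵥ (D *ᵥ u))) :=
          mul_le_mul_of_nonneg_left hc' hα'.le
        _ = (u ⬝ᵥ u) * (p1 * (1 - α) * ((D *ᵥ u) ⬝ᵥ (D *ᵥ u))) := by ring
        _ ≤ _ := mul_le_mul_of_nonneg_left ha (dotProduct_self_nonneg' u)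
  have hnoise : ((T : ℝ) * p2)⁻¹ * ∑ t ∈ Finset.range T,
      (v ᵥ* errMat e p1 p2 t ω) ⬝ᵥ (v ᵥ* errMat e p1 p2 t ω) ≤ η * p1 * (v ⬝ᵥ v) := by
    rw [inv_mul_le_iff₀ (by positivity)]
    exact (sum_vecMul_errMat_le h v).trans (le_of_eq (by ring))
  rw [form_secondMoment]
  calc _ = (1 - θ) * ((1 - γ) * ((eig hS j - β) * (p1 * (1 - α) * (v ⬝ᵥ v)))) -
          1 / θ * (η * p1 * (v ⬝ᵥ v)) := by ring
    _ ≤ (1 - θ) * (((T : ℝ) * p2)⁻¹ * ∑ t ∈ Finset.range T,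
        (C p2 *ᵥ (u ᵥ* F t ω)) ⬝ᵥ (C p2 *ᵥ (u ᵥ* F t ω))) - 1 / θ *
          (((T : ℝ) * p2)⁻¹ * ∑ t ∈ Finset.range T,
            (v ᵥ* errMat e p1 p2 t ω) ⬝ᵥ (v ᵥ* errMat e p1 p2 t ω)) := by
        refine sub_le_sub (mul_le_mul_of_nonneg_left (le_trans ?_ hsig) (by linarith))
          (mul_le_mul_of_nonneg_left hnoise (by positivity))
        refine mul_le_mul_of_nonneg_left ?_ (by linarith)
        calc _ ≤ (eig hS j - β) * (u ⬝ᵥ u) := mul_le_mul_of_nonneg_left hvw (by linarith)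
          _ ≤ _ := by linarith
    _ = ((T : ℝ) * p2)⁻¹ * ∑ t ∈ Finset.range T,
        ((1 - θ) * ((C p2 *ᵥ (u ᵥ* F t ω)) ⬝ᵥ (C p2 *ᵥ (u ᵥ* F t ω))) - 1 / θ *
          ((v ᵥ* errMat e p1 p2 t ω) ⬝ᵥ (v ᵥ* errMat e p1 p2 t ω))) := by
        rw [Finset.sum_sub_distrib, ← Finset.mul_sum, ← Finset.mul_sum]; ring
    _ ≤ _ := by
        refine mul_le_mul_of_nonneg_left (Finset.sum_le_sum fun t _ => ?_) (by positivity)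
        rw [vecMul_obs, hw]
        exact le_add_dotProduct_add _ _ hθ

theorem tendsto_lamHat_div (hB2 : AssumptionB2 R C) {S : Matrix (Fin k1) (Fin k1) ℝ}
    (hS : S.IsHermitian)
    (hF : Tendsto (fun T : ℕ => (T : ℝ)⁻¹ • ∑ t ∈ Finset.range T, F t ω * (F t ω)ᵀ) atTop (𝓝 S))
    (h : ∀ η : ℝ, 0 < η → ∀ᶠ q in minAtTop, ∀ v, noiseForm e q.1 q.2.1 q.2.2 ω v ≤
      η * q.1 * (q.2.1 * q.2.2) * ∑ i ∈ Finset.range q.1, v i ^ 2)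
    {j : ℕ} (h1 : 1 ≤ j) (hj : j ≤ k1) (hpos : 0 < eig hS j) :
    Tendsto (fun q : ℕ × ℕ × ℕ => lamHat R C F e j q.1 q.2.1 q.2.2 ω / (q.1 : ℝ))
      minAtTop (𝓝 (eig hS j)) := by
  have hα := hB2.lim_R.comp tendsto_fst_minAtTop
  have hγ := hB2.lim_C.comp tendsto_snd_minAtTop
  have hβ := (tendsto_iff_norm_sub_tendsto_zero.1 hF).comp tendsto_thd_minAtTop
  have hdim := ((tendsto_fst_minAtTop.eventually_ge_atTop (k1 + 1)).and
    (tendsto_snd_minAtTop.eventually_ge_atTop 1)).and (tendsto_thd_minAtTop.eventually_ge_atTop 1)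
  set lam := eig hS j with hlam
  rw [tendsto_order]
  constructor
  · intro a ha
    -- The noise level is taken as η = θ², so its Young coefficient 1 / θ costs only θ.
    obtain ⟨θ, hθ0, hθ1, hθ⟩ : ∃ θ : ℝ, 0 < θ ∧ θ ≤ 1 ∧ a < (1 - θ) * lam - θ := by
      have hlim : Tendsto (fun θ : ℝ => (1 - θ) * lam - θ) (𝓝[>] 0) (𝓝 ((1 - 0) * lam - 0)) :=
        (Continuous.tendsto (by fun_prop) 0).mono_left nhdsWithin_le_nhds
      have h3 := hlim.eventually_const_lt (show a < (1 - 0) * lam - 0 by simpa using ha)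
      obtain ⟨θ, hθ, hθ'⟩ := (h3.and (Ioc_mem_nhdsGT (zero_lt_one' ℝ))).exists
      exact ⟨θ, hθ'.1, hθ'.2, hθ⟩
    have hlim := ((((tendsto_const_nhds (x := (1 : ℝ))).sub hγ).mul
      (((tendsto_const_nhds (x := lam)).sub hβ).mul
        ((tendsto_const_nhds (x := (1 : ℝ))).sub hα))).const_mul (1 - θ)).sub_const (1 / θ * θ ^ 2)
    have hev := hlim.eventually_const_lt (u := a) (by
      rw [show 1 / θ * θ ^ 2 = θ by field_simp]; simpa using hθ)
    filter_upwards [hev, hdim, h (θ ^ 2) (by positivity), hα.eventually_lt_const zero_lt_one,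
      hγ.eventually_lt_const zero_lt_one, hβ.eventually_lt_const hpos]
      with q hq hd hn hq1 hq2 hq3
    rw [lt_div_iff₀ (by exact_mod_cast (by omega : 0 < q.1))]
    refine lt_of_lt_of_le (mul_lt_mul_of_pos_right hq (by exact_mod_cast (by omega : 0 < q.1))) ?_
    exact le_lamHat hS hθ0 hθ1 (by omega) (by omega) (by omega) hn h1 hj (by omega) hq1 hq2.le
      hq3.le
  · intro a ha
    obtain ⟨θ, hθ0, hθ⟩ : ∃ θ : ℝ, 0 < θ ∧ (1 + θ) * lam + (1 + 1 / θ) * θ ^ 2 < a := by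
      have hlim : Tendsto (fun θ : ℝ => (1 + θ) * lam + (θ ^ 2 + θ)) (𝓝[>] 0)
          (𝓝 ((1 + 0) * lam + (0 ^ 2 + 0))) :=
        (Continuous.tendsto (by fun_prop) 0).mono_left nhdsWithin_le_nhds
      have h3 := hlim.eventually_lt_const (show (1 + 0) * lam + (0 ^ 2 + 0) < a by simpa using ha)
      obtain ⟨θ, hθ, hθ'⟩ := (h3.and self_mem_nhdsWithin).exists
      have hθ0 : (0 : ℝ) < θ := hθ'
      refine ⟨θ, hθ0, ?_⟩
      rwa [show (1 + 1 / θ) * θ ^ 2 = θ ^ 2 + θ by field_simp]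
    have hlim := ((((tendsto_const_nhds (x := (1 : ℝ))).add hγ).mul
      (((tendsto_const_nhds (x := lam)).add hβ).mul
        ((tendsto_const_nhds (x := (1 : ℝ))).add hα))).const_mul (1 + θ)).add_const
          ((1 + 1 / θ) * θ ^ 2)
    have hev := hlim.eventually_lt_const (u := a) (by simpa using hθ)
    filter_upwards [hev, hdim, h (θ ^ 2) (by positivity)] with q hq hd hn
    rw [div_lt_iff₀ (by exact_mod_cast (by omega : 0 < q.1))]
    refine lt_of_le_of_lt ?_ (mul_lt_mul_of_pos_right hq
      (by exact_mod_cast (by omega : 0 < q.1)))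
    exact lamHat_le hS hθ0 (by omega) (by omega) (by omega) hn h1 hj (by omega) hpos.le

end MatrixFactor

/-! ### The three claims -/

theorem theorem1 {Ω : Type*} [MeasurableSpace Ω] (μ : Measure Ω) [IsProbabilityMeasure μ]
    (k1 k2 : ℕ)
    (R : ∀ p1 : ℕ, Matrix (Fin p1) (Fin k1) ℝ) (C : ∀ p2 : ℕ, Matrix (Fin p2) (Fin k2) ℝ)
    (F : ℕ → Ω → Matrix (Fin k1) (Fin k2) ℝ) (e : ℕ → ℕ → ℕ → Ω → ℝ)
    (hF : ∀ t a b, Measurable fun ω => F t ω a b) (he : ∀ i j t, Measurable (e i j t))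
    (hB1 : MatrixFactor.AssumptionB1 μ F) (hB2 : MatrixFactor.AssumptionB2 R C)
    (hB3 : MatrixFactor.AssumptionB3 μ e) (hB4 : MatrixFactor.AssumptionB4 μ F e) :
    -- the first `k1` eigenvalues are of exact order `p1`
    (∀ j : ℕ, 1 ≤ j → j ≤ k1 → ∃ c : ℝ, 0 < c ∧ ∀ᵐ ω ∂μ,
      Tendsto (fun q : ℕ × ℕ × ℕ =>
          MatrixFactor.lamHat R C F e j q.1 q.2.1 q.2.2 ω / (q.1 : ℝ))
        (comap (fun q : ℕ × ℕ × ℕ => min q.1 (min q.2.1 q.2.2)) atTop) (𝓝 c)) ∧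
    -- the remaining eigenvalues are at most a constant plus `o(rate)`, uniformly in `j`
    (∃ c : ℝ, ∀ ε : ℝ, 0 < ε → ∀ᵐ ω ∂μ, ∀ δ : ℝ, 0 < δ →
      ∀ᶠ q : ℕ × ℕ × ℕ in comap (fun q : ℕ × ℕ × ℕ => min q.1 (min q.2.1 q.2.2)) atTop,
        ∀ j : ℕ, k1 < j → j ≤ q.1 →
          MatrixFactor.lamHat R C F e j q.1 q.2.1 q.2.2 ω
            ≤ c + δ * MatrixFactor.rate ε q.1 q.2.1 q.2.2) ∧
    -- the eigen-gap
    (1 ≤ k1 → ∀ᵐ ω ∂μ,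
      Tendsto (fun q : ℕ × ℕ × ℕ =>
          MatrixFactor.lamHat R C F e (k1 + 1) q.1 q.2.1 q.2.2 ω
            / MatrixFactor.lamHat R C F e k1 q.1 q.2.1 q.2.2 ω)
        (comap (fun q : ℕ × ℕ × ℕ => min q.1 (min q.2.1 q.2.2)) atTop) (𝓝 0)) := by

  obtain ⟨S, ⟨hSpos, -⟩, hFS⟩ := hB1.cov_row
  have hdim := hB3.ae_noiseForm_le_dim he
  have htop : ∀ j : ℕ, 1 ≤ j → j ≤ k1 → ∃ c : ℝ, 0 < c ∧ ∀ᵐ ω ∂μ,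
      Tendsto (fun q : ℕ × ℕ × ℕ =>
          MatrixFactor.lamHat R C F e j q.1 q.2.1 q.2.2 ω / (q.1 : ℝ))
        MatrixFactor.minAtTop (𝓝 c) := by
    intro j h1 hj
    -- The limit is the j-th largest eigenvalue of the limiting row covariance S.
    refine ⟨_, MatrixFactor.eig_pos hSpos h1 hj, ?_⟩
    filter_upwards [hFS, hdim] with ω hω hn
    exact MatrixFactor.tendsto_lamHat_div hB2 _ hω hn h1 hj (MatrixFactor.eig_pos hSpos h1 hj)
  refine ⟨htop, ?_, fun hk => ?_⟩
  · obtain ⟨c, hc⟩ := hB3.ae_noiseForm_le_rate he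
    refine ⟨c, fun ε hε => ?_⟩
    filter_upwards [hc ε hε] with ω hω δ hδ
    filter_upwards [hω δ hδ, MatrixFactor.tendsto_snd_minAtTop.eventually_ge_atTop 1,
      MatrixFactor.tendsto_thd_minAtTop.eventually_ge_atTop 1] with q hq h2 h3 j hj hjp
    exact MatrixFactor.lamHat_le_of_noise h2 h3 hq hj hjp
  · obtain ⟨c, hc0, hc⟩ := htop k1 hk le_rfl
    filter_upwards [hc, hdim] with ω hω hn
    -- This uses the o(p1) noise bound, since the rate in the second claim may exceed p1.
    have hzero : Tendsto (fun q : ℕ × ℕ × ℕ =>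
        MatrixFactor.lamHat R C F e (k1 + 1) q.1 q.2.1 q.2.2 ω / (q.1 : ℝ))
        MatrixFactor.minAtTop (𝓝 0) := by
      rw [tendsto_order]
      refine ⟨fun a ha => Eventually.of_forall fun q => ha.trans_le
        (div_nonneg (MatrixFactor.lamHat_nonneg _) (by positivity)), fun a ha => ?_⟩
      filter_upwards [hn (a / 2) (by positivity),
        MatrixFactor.tendsto_fst_minAtTop.eventually_ge_atTop (k1 + 1),
        MatrixFactor.tendsto_snd_minAtTop.eventually_ge_atTop 1,
        MatrixFactor.tendsto_thd_minAtTop.eventually_ge_atTop 1] with q hq h1 h2 h3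
      have hq0 : (0 : ℝ) < q.1 := by exact_mod_cast (by omega : 0 < q.1)
      rw [div_lt_iff₀ hq0]
      refine (MatrixFactor.lamHat_le_of_noise h2 h3 hq (Nat.lt_succ_self k1) h1).trans_lt ?_
      exact mul_lt_mul_of_pos_right (by linarith) hq0
    have hdiv := hzero.div hω hc0.ne'
    rw [zero_div] at hdiv
    refine hdiv.congr' ?_
    filter_upwards [MatrixFactor.tendsto_fst_minAtTop.eventually_ge_atTop 1] with q hq
    exact div_div_div_cancel_right₀ (by positivity) _ _
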